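/- Let $d\ge 1$, let $\mathcal L$ be Lebesgue measure on $\mathbb R^d$, and let $\mathfrak G$ be the set of all subsets of $\mathbb R^d$ of diameter strictly smaller than $1$. Let $\mathcal F$ be a $\sigma$-algebra on $\mathfrak G$ and $\mu$ a measure on $(\mathfrak G,\mathcal F)$ which are suitable in the following sense: $\mathcal F$ is stable under $\mathcal D\mapsto x+\mathcal D=\{x+G:G\in\mathcal D\}$ ($x\in\mathbb R^d$) and under $\mathcal D\mapsto\{G\in\mathfrak G:G/s\in\mathcal D\}$ ($s>0$); for every point $x$ and every open ball $B$ the families $\{G\in\mathfrak G:x\in G\}$, $\{G\in\mathfrak G:G\cap B\neq\emptyset\}$ and $\{G\in\mathfrak G:B\subset G\}$ belong to $\mathcal F$; and there is $\mathcal K\in\mathcal F$ with $\mu(\mathfrak G\setminus\mathcal K)=0$ such that $\{(x,G):G\in\mathcal K,\ x\in G\}$ is measurable for the product of the Borel $\sigma$-algebra of $\mathbb R^d$ and $\mathcal F$. Suppose that $\mu$ is translation invariant, i.e. $\mu(x+\mathcal D)=\mu(\mathcal D)$ for all $x\in\mathbb R^d$ and $\mathcal D\in\mathcal F$, and semi scale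 invariant, i.e. $\mu(\mathcal D_s)=\mu(\mathcal D)$ whenever $0<s<\infty$, $\mathcal D\in\mathcal F$, $\mu(\mathcal D)<\infty$ and $\mathcal D_s:=\{G\subset\mathbb R^d:G/s\in\mathcal D\}$ contains only sets of diameter strictly smaller than $1$. Suppose moreover that 1. $\mu(G\in\mathfrak G: G\cap A\neq\emptyset,\ \mathrm{diam}(G)\ge\delta)<\infty$ for every bounded $A\subset\mathbb R^d$ and every $\delta>0$; 2. $\mu(G\in\mathfrak G:\mathcal L(\partial G)>0)=0$; 3. $\mu(G\in\mathfrak G:\mathcal L(G)>0)>0$; and that, with $\mathcal A_1:=\{G\in\mathfrak G:0\in G,\ 1/2\le\mathrm{diam}(G)<1\}$, $[\partial G]^r:=\{x\in G:d(x,\partial G)<r\}$ and $\mu_p:=\mu(\,\cdot\,\cap\{G:\mathcal L(G)>0\})$, $$\int_{\mathcal A_1}\int_0^1\frac1r\,\frac{\mathcal L([\partial G]^r)}{\mathcal L(G)}\,dr\,d\mu_p(G)<\infty .$$ For every $0<\lambda<\infty$ let $\Phi_\lambda$ be a Poisson process on $\mathfrak G$ with intensity measure $\lambda\mu$ (all defined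 on one probability space, with any joint law), let $$\mathcal C(\lambda):=\mathbb R^d\setminus\bigcup_{G\in\Phi_\lambda}G,\qquad \lambda_e:=\inf\{\lambda>0:\mathcal C(\lambda)=\emptyset\text{ almost surely}\}.$$ Then $0<\lambda_e<\infty$ and $\mathcal C(\lambda_e)=\emptyset$ almost surely. -/

import Mathlib

open MeasureTheory ProbabilityTheory Set
open scoped ENNReal

noncomputable section

namespace PoissonFractal

/-- Euclidean space `ℝ^d`. -/
abbrev E (d : ℕ) : Type := EuclideanSpace ℝ (Fin d)

/-- The space `𝔊` of all subsets of `ℝ^d` with diameter strictly smaller than one. No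
σ-algebra is fixed on it here. -/
structure SmallSet (d : ℕ) : Type where
  /-- the underlying subset of `ℝ^d` -/
  carrier : Set (E d)
  /-- its diameter is strictly smaller than one -/
  ediam_lt_one : Metric.ediam carrier < 1

namespace SmallSet

variable {d : ℕ}

/-- The translate `x + G`. -/
def translate (x : E d) (G : SmallSet d) : SmallSet d where
  carrier := (fun y => x + y) '' G.carrier
  ediam_lt_one := by
    have h : Isometry (fun y : E d => x + y) := isometry_add_left x
    rw [h.ediam_image]
    exact G.ediam_lt_one

/-- The diameter of `G`, as a real number. -/
def diam (G : SmallSet d) : ℝ := Metric.diam G.carrier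

/-- The Lebesgue measure of `G`. -/
def vol (G : SmallSet d) : ℝ≥0∞ := volume G.carrier

/-- The inner `r`-neighbourhood `[∂G]^r = {x ∈ G : d(x, ∂G) < r}` of the boundary of `G`. -/
def innerNhd (G : SmallSet d) (r : ℝ) : Set (E d) :=
  {x | x ∈ G.carrier ∧ Metric.infEDist x (frontier G.carrier) < ENNReal.ofReal r}

end SmallSet

variable {d : ℕ}

/-- `𝒟_s = {G : G / s ∈ 𝒟}`, as a subset of `𝔊`. -/
def dilate (s : ℝ) (D : Set (SmallSet d)) : Set (SmallSet d) :=
  {G | ∃ H ∈ D, H.carrier = (fun y => s⁻¹ • y) '' G.carrier}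

/-- All the sets `s G`, `G ∈ 𝒟`, still have diameter strictly smaller than one, that is, the
family `{G ⊆ ℝ^d : G / s ∈ 𝒟}` is contained in `𝔊`. -/
def DilateSmall (s : ℝ) (D : Set (SmallSet d)) : Prop :=
  ∀ H ∈ D, Metric.ediam ((fun y => s • y) '' H.carrier) < 1

/-- The ambient σ-algebra on `𝔊` is suitable for the measure `μ`: it is stable under translations
and dilations, the elementary events "`G` contains the point `x`", "`G` hits an open ball" and
"`G` contains an open ball" are measurable, and `μ` is carried by a measurable class of sets
on which the relation `x ∈ G` is jointly measurable in `(x, G)`. (It is impossible to have the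
last property on all of `𝔊`, because sections of measurable sets are measurable, so that it makes
every set of the class a Borel set.) -/
structure IsSuitable [MeasurableSpace (SmallSet d)] (μ : Measure (SmallSet d)) : Prop where
  translate_image : ∀ (x : E d) (D : Set (SmallSet d)), MeasurableSet D →
    MeasurableSet (SmallSet.translate x '' D)
  measurableSet_dilate : ∀ (s : ℝ) (D : Set (SmallSet d)), 0 < s → MeasurableSet D →
    MeasurableSet (dilate s D)
  point : ∀ x : E d, MeasurableSet {G : SmallSet d | x ∈ G.carrier}
  hit : ∀ (x : E d) (r : ℝ),
    MeasurableSet {G : SmallSet d | (G.carrier ∩ Metric.ball x r).Nonempty}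
  contain : ∀ (x : E d) (r : ℝ),
    MeasurableSet {G : SmallSet d | Metric.ball x r ⊆ G.carrier}
  joint : ∃ K : Set (SmallSet d), MeasurableSet K ∧ μ Kᶜ = 0 ∧
    MeasurableSet {p : E d × SmallSet d | p.2 ∈ K ∧ p.1 ∈ p.2.carrier}

/-- Translation invariance: `μ(x + 𝒟) = μ(𝒟)`. -/
def TranslationInvariant [MeasurableSpace (SmallSet d)] (μ : Measure (SmallSet d)) : Prop :=
  ∀ (x : E d) (D : Set (SmallSet d)), MeasurableSet D → μ (SmallSet.translate x '' D) = μ D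

/-- Semi scale invariance: `μ(𝒟_s) = μ(𝒟)` whenever `μ(𝒟) < ∞` and `𝒟_s` only contains sets of
diameter strictly smaller than one. -/
def SemiScaleInvariant [MeasurableSpace (SmallSet d)] (μ : Measure (SmallSet d)) : Prop :=
  ∀ (s : ℝ) (D : Set (SmallSet d)), 0 < s → MeasurableSet D → μ D < ∞ → DilateSmall s D →
    μ (dilate s D) = μ D

/-- Local finiteness: for bounded `A` and `δ > 0`, the sets of diameter at least `δ` hitting `A`
have finite total mass. -/
def LocallyFinite [MeasurableSpace (SmallSet d)] (μ : Measure (SmallSet d)) : Prop :=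
  ∀ (A : Set (E d)) (δ : ℝ), Bornology.IsBounded A → 0 < δ →
    μ {G | (G.carrier ∩ A).Nonempty ∧ δ ≤ G.diam} < ∞

/-- Almost all sets have a boundary of zero Lebesgue measure. -/
def NullBoundary [MeasurableSpace (SmallSet d)] (μ : Measure (SmallSet d)) : Prop :=
  μ {G | 0 < volume (frontier G.carrier)} = 0

/-- The sets of positive Lebesgue measure have positive mass. -/
def ChargesPositiveVolume [MeasurableSpace (SmallSet d)] (μ : Measure (SmallSet d)) : Prop :=
  0 < μ {G | 0 < G.vol}

/-- The part `μ_p` of `μ` on the sets of positive Lebesgue measure. -/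
def positivePart [MeasurableSpace (SmallSet d)] (μ : Measure (SmallSet d)) :
    Measure (SmallSet d) :=
  μ.restrict {G | 0 < G.vol}

/-- `𝒜_l`: the sets containing the origin, of diameter in `[2^{-l}, 2^{-l+1})`. -/
def annulus (d : ℕ) (l : ℤ) : Set (SmallSet d) :=
  {G | (0 : E d) ∈ G.carrier ∧ (2 : ℝ) ^ (-l) ≤ G.diam ∧ G.diam < (2 : ℝ) ^ (-l + 1)}

/-- The integrability condition
`∫_{𝒜_1} ∫_0^1 (1/r) (𝓛([∂G]^r) / 𝓛(G)) dr dμ_p(G) < ∞`. -/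
def BoundaryIntegrable [MeasurableSpace (SmallSet d)] (μ : Measure (SmallSet d)) : Prop :=
  ∫⁻ G in annulus d 1, (∫⁻ r in Ioo (0 : ℝ) 1,
    ENNReal.ofReal (1 / r) * (volume (G.innerNhd r) / G.vol)) ∂(positivePart μ) < ∞

/-- A random at most countable collection of points of `S`, listed with multiplicity: the points
are `point n ω` for `n < total ω`. -/
structure PointProcess (Ω S : Type*) where
  /-- the total number of points -/
  total : Ω → ℕ∞
  /-- the points -/
  point : ℕ → Ω → S

/-- The number of points of the process in the set `A`. -/
def PointProcess.count {Ω S : Type*} (Φ : PointProcess Ω S) (A : Set S) (ω : Ω) : ℕ∞ :=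
  Set.encard {n : ℕ | (n : ℕ∞) < Φ.total ω ∧ Φ.point n ω ∈ A}

/-- `Φ` is a Poisson process on `S` with intensity measure `ν`: the number of points in `A` is
Poisson distributed with mean `ν A` (almost surely infinite if `ν A = ∞`), and the numbers of
points in disjoint sets are independent. -/
structure IsPoissonProcess {Ω S : Type*} [MeasurableSpace Ω] [MeasurableSpace S]
    (P : Measure Ω) (ν : Measure S) (Φ : PointProcess Ω S) : Prop where
  measurable_total : Measurable Φ.total
  measurable_point : ∀ n, Measurable (Φ.point n)
  count_law : ∀ A : Set S, MeasurableSet A → ν A ≠ ∞ →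
    HasLaw (Φ.count A) ((poissonMeasure (ν A).toNNReal).map (Nat.cast : ℕ → ℕ∞)) P
  count_top : ∀ A : Set S, MeasurableSet A → ν A = ∞ → ∀ᵐ ω ∂P, Φ.count A ω = ⊤
  indep : ∀ (m : ℕ) (A : Fin m → Set S), (∀ i, MeasurableSet (A i)) →
    Pairwise (fun i j => Disjoint (A i) (A j)) → iIndepFun (fun i => Φ.count (A i)) P

/-- The uncovered set `𝒞 = ℝ^d \ ⋃_{G ∈ Φ} G`. -/
def uncovered {Ω : Type*} (Φ : PointProcess Ω (SmallSet d)) (ω : Ω) : Set (E d) :=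
  (⋃ (n : ℕ) (_ : (n : ℕ∞) < Φ.total ω), (Φ.point n ω).carrier)ᶜ

/-- The critical value `λ_e = inf {λ > 0 : 𝒞(λ) = ∅ almost surely}`. -/
def criticalValue {Ω : Type*} [MeasurableSpace Ω] (P : Measure Ω)
    (Φ : ℝ → PointProcess Ω (SmallSet d)) : ℝ :=
  sInf {t : ℝ | 0 < t ∧ ∀ᵐ ω ∂P, uncovered (Φ t) ω = ∅}

end PoissonFractal

end

/-!
The critical value is shown to be `d log 2 / m`, where `m = unitMass μ` is the mass of the sets
with `1/2 ≤ diam G < 1` that have the origin in their interior. By Fubini and the null boundary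
condition (`measure_frontierFam`), `m` is also the mass of the sets having the origin in their
closure, and by scale invariance each dyadic range of diameters contributes the same mass. So a
given point is uncovered by the sets of diameter at least `2⁻ⁿ` with probability `exp (-t n m)`,
and there are about `2 ^ (d n)` cells of mesh `2⁻ⁿ` in the unit cube. About the Poisson process
only the void probabilities are used; void events are stable under intersections, so that they
also give the independence of the process on disjoint families
(`IsPoissonProcess.measure_inter_void`).

*Below the critical value* (`not_ae_uncovered_eq_empty`) a second moment argument applies. Each
`G` is replaced by the open set of points within `ε * diam G` of it, with `ε` so small that the
intensity is still subcritical (`exists_nearFam_lt`). The points of the unit ball outside these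
sets up to scale `2⁻ⁿ` form decreasing compact sets (`farSet`). The normalised Lebesgue measures
on them have constant mean mass, and by the two-point estimate `measure_void_pair_le` they have
bounded mean `α`-energy for some `α > 0`. With positive probability the masses are therefore
bounded below and the energies bounded above infinitely often; bounded energy rules out
concentration near points, so the intersection of the compact sets is not countable
(`exists_mem_iInter_notMem`). This matters because `Φ` may contain infinitely many sets of
diameter zero, which cover a countable set.

*At the critical value* (`ae_uncovered_eq_empty`) one counts the bad cells, those cells of mesh
`2⁻ⁿ` for which a ball of comparable size is not contained in a single set of `Φ` of diameter at
least `2⁻ⁿ`. Compared with the uncovering of a point, this costs a bounded factor. Indeed, by a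
mass transport argument (`lintegral_boundary_ratio`) the integrability condition says that the
masses of the sets with the origin in their interior, but at distance less than `2⁻ʲ` from the
boundary, are summable in `j`. So at criticality the mean number of bad cells is bounded
(`exists_sum_void_le`). On the other hand, given at most `M` bad cells, they are all covered by
somewhat smaller sets with a probability bounded below (`exists_kill`). Hence the bad cells die
out almost surely (`measure_iInter_survival`), and everything is covered.
-/

open Filter Topology Metric TopologicalSpace

namespace PoissonFractal

variable {d : ℕ}

/-! ### Measurability of the elementary families of sets -/

/-- Every point of a ball lies in a smaller ball with centre in a fixed countable dense set and
rational radius. -/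
lemma exists_denseSeq_ball {x y : E d} {r : ℝ} (hy : y ∈ ball x r) :
    ∃ p : ℕ × ℚ, y ∈ ball (denseSeq (E d) p.1) p.2 ∧ dist (denseSeq (E d) p.1) x + p.2 ≤ r := by
  have hy' : dist y x < r := hy
  obtain ⟨s, hs0, hs⟩ := exists_rat_btwn (show (0 : ℝ) < (r - dist y x) / 2 by linarith)
  obtain ⟨n, hn⟩ := (denseRange_denseSeq (E d)).exists_dist_lt y hs0
  refine ⟨(n, s), hn, ?_⟩
  have := dist_triangle (denseSeq (E d) n) y x
  rw [dist_comm (denseSeq (E d) n) y] at this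
  dsimp only
  linarith

lemma hit_ball_iff {A : Set (E d)} {x : E d} {r : ℝ} :
    (A ∩ ball x r).Nonempty ↔ ∃ p : ℕ × ℚ, dist (denseSeq (E d) p.1) x + p.2 ≤ r ∧
      (A ∩ ball (denseSeq (E d) p.1) p.2).Nonempty := by
  constructor
  · rintro ⟨y, hyA, hy⟩
    obtain ⟨p, hp, hpr⟩ := exists_denseSeq_ball hy
    exact ⟨p, hpr, y, hyA, hp⟩
  · rintro ⟨p, hp, y, hyA, hy⟩
    exact ⟨y, hyA, ball_subset_ball' (by linarith) hy⟩

lemma ball_subset_iff {A : Set (E d)} {x : E d} {r : ℝ} :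
    ball x r ⊆ A ↔ ∀ p : ℕ × ℚ, dist (denseSeq (E d) p.1) x + p.2 ≤ r →
      ball (denseSeq (E d) p.1) p.2 ⊆ A := by
  constructor
  · intro h p hp
    exact (ball_subset_ball' (by linarith)).trans h
  · intro h y hy
    obtain ⟨p, hp, hpr⟩ := exists_denseSeq_ball hy
    exact h p hpr hp

lemma SmallSet.isBounded (G : SmallSet d) : Bornology.IsBounded G.carrier :=
  isBounded_iff_ediam_ne_top.2 (G.ediam_lt_one.trans ENNReal.one_lt_top).ne

lemma SmallSet.diam_nonneg (G : SmallSet d) : 0 ≤ G.diam := Metric.diam_nonneg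

lemma SmallSet.diam_lt_one (G : SmallSet d) : G.diam < 1 := by
  have := (ENNReal.toReal_lt_toReal (G.ediam_lt_one.trans ENNReal.one_lt_top).ne
    ENNReal.one_ne_top).2 G.ediam_lt_one
  rwa [ENNReal.toReal_one] at this

lemma SmallSet.dist_le_diam (G : SmallSet d) {x y : E d} (hx : x ∈ G.carrier)
    (hy : y ∈ G.carrier) : dist x y ≤ G.diam :=
  Metric.dist_le_diam_of_mem G.isBounded hx hy

lemma SmallSet.diam_translate (x : E d) (G : SmallSet d) : (G.translate x).diam = G.diam :=
  (isometry_add_left x).diam_image _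

lemma SmallSet.ext' {G H : SmallSet d} (h : G.carrier = H.carrier) : G = H := by
  cases G; cases H; simp_all

lemma SmallSet.translate_translate_neg (x : E d) (G : SmallSet d) :
    (G.translate (-x)).translate x = G := by
  apply SmallSet.ext'
  ext y
  simp [SmallSet.translate]

lemma SmallSet.mem_translate {x y : E d} {G : SmallSet d} :
    y ∈ (G.translate x).carrier ↔ y - x ∈ G.carrier := by
  simp only [SmallSet.translate, mem_image]
  constructor
  · rintro ⟨z, hz, rfl⟩; simpa using hz
  · intro h; exact ⟨_, h, by simp⟩

lemma SmallSet.ball_subset_translate {x y : E d} {r : ℝ} {G : SmallSet d} :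
    ball y r ⊆ (G.translate x).carrier ↔ ball (y - x) r ⊆ G.carrier := by
  constructor
  · intro h z hz
    have := h (show z + x ∈ ball y r by
      rw [mem_ball, dist_eq_norm] at hz ⊢; rwa [show z + x - y = z - (y - x) by abel])
    rw [SmallSet.mem_translate] at this
    simpa using this
  · intro h z hz
    rw [SmallSet.mem_translate]
    apply h
    rw [mem_ball, dist_eq_norm] at hz ⊢
    rwa [show z - x - (y - x) = z - y by abel]

lemma SmallSet.hit_translate {x y : E d} {r : ℝ} {G : SmallSet d} :
    ((G.translate x).carrier ∩ ball y r).Nonempty ↔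
      (G.carrier ∩ ball (y - x) r).Nonempty := by
  constructor
  · rintro ⟨z, hz, hzb⟩
    refine ⟨z - x, SmallSet.mem_translate.1 hz, ?_⟩
    rw [mem_ball, dist_eq_norm] at hzb ⊢
    rwa [show z - x - (y - x) = z - y by abel]
  · rintro ⟨z, hz, hzb⟩
    refine ⟨z + x, SmallSet.mem_translate.2 (by simpa using hz), ?_⟩
    rw [mem_ball, dist_eq_norm] at hzb ⊢
    rwa [show z + x - y = z - (y - x) by abel]

lemma exists_pow_le_lt {x θ : ℝ} (hx0 : 0 < x) (hx1 : x < 1) (hθ0 : 0 < θ) (hθ1 : θ < 1) :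
    ∃ n : ℕ, θ ^ (n + 1) ≤ x ∧ x < θ ^ n := by
  obtain ⟨n, hn, hn'⟩ := exists_nat_pow_near_of_lt_one hx0 hx1.le hθ0 hθ1
  rcases hn'.lt_or_eq with hlt | heq
  · exact ⟨n, hn.le, hlt⟩
  · cases n with
    | zero => exact absurd heq (by rw [pow_zero]; exact hx1.ne)
    | succ n => exact ⟨n, heq.ge, heq ▸ pow_lt_pow_right_of_lt_one₀ hθ0 hθ1 n.lt_succ_self⟩

lemma mem_interior_iff_nat {A : Set (E d)} {x : E d} :
    x ∈ interior A ↔ ∃ n : ℕ, ball x ((1 / 2 : ℝ) ^ n) ⊆ A := by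
  rw [mem_interior_iff_mem_nhds, Metric.mem_nhds_iff]
  constructor
  · rintro ⟨ε, hε, h⟩
    obtain ⟨n, hn⟩ := exists_pow_lt_of_lt_one hε (show (1 / 2 : ℝ) < 1 by norm_num)
    exact ⟨n, (ball_subset_ball hn.le).trans h⟩
  · rintro ⟨n, h⟩
    exact ⟨_, by positivity, h⟩

lemma mem_closure_iff_nat {A : Set (E d)} {x : E d} :
    x ∈ closure A ↔ ∀ n : ℕ, (A ∩ ball x ((1 / 2 : ℝ) ^ n)).Nonempty := by
  rw [Metric.mem_closure_iff]
  constructor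
  · intro h n
    obtain ⟨b, hb, hbx⟩ := h ((1 / 2 : ℝ) ^ n) (by positivity)
    exact ⟨b, hb, by rwa [mem_ball, dist_comm]⟩
  · intro h ε hε
    obtain ⟨n, hn⟩ := exists_pow_lt_of_lt_one hε (show (1 / 2 : ℝ) < 1 by norm_num)
    obtain ⟨b, hb, hbx⟩ := h n
    exact ⟨b, hb, by rw [dist_comm]; exact (mem_ball.1 hbx).trans hn⟩

lemma SmallSet.mem_interior_translate {x y : E d} {G : SmallSet d} :
    y ∈ interior (G.translate x).carrier ↔ y - x ∈ interior G.carrier := by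
  simp only [mem_interior_iff_nat, SmallSet.ball_subset_translate]

lemma SmallSet.mem_closure_translate {x y : E d} {G : SmallSet d} :
    y ∈ closure (G.translate x).carrier ↔ y - x ∈ closure G.carrier := by
  simp only [mem_closure_iff_nat, SmallSet.hit_translate]

section Measurability

variable [MeasurableSpace (SmallSet d)] {μ : Measure (SmallSet d)}

/-- The diameter is larger than `c` if and only if `G` hits two balls of a countable family whose
distance from each other is larger than `c`. -/
lemma IsSuitable.measurable_diam (h : IsSuitable μ) :
    Measurable (SmallSet.diam : SmallSet d → ℝ) := by
  refine measurable_of_Ioi fun c => ?_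
  rcases lt_or_ge c 0 with hc | hc
  · convert MeasurableSet.univ
    ext G
    simpa using hc.trans_le G.diam_nonneg
  have : SmallSet.diam ⁻¹' Ioi c = ⋃ (p : ℕ × ℚ) (q : ℕ × ℚ)
      (_ : c < dist (denseSeq (E d) p.1) (denseSeq (E d) q.1) - p.2 - q.2),
      {G : SmallSet d | (G.carrier ∩ ball (denseSeq (E d) p.1) p.2).Nonempty} ∩
      {G : SmallSet d | (G.carrier ∩ ball (denseSeq (E d) q.1) q.2).Nonempty} := by
    ext G
    simp only [mem_preimage, mem_Ioi, mem_iUnion, mem_inter_iff, mem_ofPred_eq, exists_prop]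
    constructor
    · intro hG
      obtain ⟨x, hx, y, hy, hxy⟩ : ∃ x ∈ G.carrier, ∃ y ∈ G.carrier, c < dist x y := by
        by_contra! hcon
        exact hG.not_ge (Metric.diam_le_of_forall_dist_le hc hcon)
      have hη : 0 < (dist x y - c) / 4 := by linarith
      obtain ⟨p, hp, hp'⟩ := exists_denseSeq_ball (mem_ball_self (x := x) hη)
      obtain ⟨q, hq, hq'⟩ := exists_denseSeq_ball (mem_ball_self (x := y) hη)
      refine ⟨p, q, ?_, ⟨x, hx, hp⟩, ⟨y, hy, hq⟩⟩
      have h1 := dist_triangle4 x (denseSeq (E d) p.1) (denseSeq (E d) q.1) y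
      rw [dist_comm x (denseSeq (E d) p.1)] at h1
      have h2 : 0 ≤ dist (denseSeq (E d) p.1) x := dist_nonneg
      have h3 : 0 ≤ dist (denseSeq (E d) q.1) y := dist_nonneg
      simp only [mem_ball] at hp hq
      linarith
    · rintro ⟨p, q, hpq, ⟨x, hx, hxp⟩, ⟨y, hy, hyq⟩⟩
      refine lt_of_lt_of_le ?_ (G.dist_le_diam hx hy)
      have h1 := dist_triangle4 (denseSeq (E d) p.1) x y (denseSeq (E d) q.1)
      rw [mem_ball] at hxp hyq
      rw [dist_comm _ x] at h1
      linarith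
  rw [this]
  exact .iUnion fun p => .iUnion fun q => .iUnion fun _ => (h.hit _ _).inter (h.hit _ _)

lemma IsSuitable.measurableSet_le_diam (h : IsSuitable μ) (a : ℝ) :
    MeasurableSet {G : SmallSet d | a ≤ G.diam} :=
  measurableSet_le measurable_const h.measurable_diam

lemma IsSuitable.measurableSet_diam_lt (h : IsSuitable μ) (a : ℝ) :
    MeasurableSet {G : SmallSet d | G.diam < a} :=
  measurableSet_lt h.measurable_diam measurable_const

/-- The relation `B(x, f(x, G)) ⊆ G` is jointly measurable in `(x, G)`. -/
lemma IsSuitable.joint_contain (h : IsSuitable μ) {f : E d × SmallSet d → ℝ}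
    (hf : Measurable f) :
    MeasurableSet {p : E d × SmallSet d | ball p.1 (f p) ⊆ p.2.carrier} := by
  have : {p : E d × SmallSet d | ball p.1 (f p) ⊆ p.2.carrier} = ⋂ q : ℕ × ℚ,
      ({p : E d × SmallSet d | dist (denseSeq (E d) q.1) p.1 + q.2 ≤ f p}ᶜ ∪
        Prod.snd ⁻¹' {G : SmallSet d | ball (denseSeq (E d) q.1) q.2 ⊆ G.carrier}) := by
    ext p
    rw [mem_ofPred_eq, ball_subset_iff]
    simp only [mem_ofPred_eq, mem_iInter, mem_union, mem_compl_iff, mem_preimage, imp_iff_not_or]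
  rw [this]
  refine .iInter fun q => .union (.compl ?_) (measurable_snd (h.contain _ _))
  exact measurableSet_le (by fun_prop) hf

/-- The relation `G ∩ B(x, f(x, G)) ≠ ∅` is jointly measurable in `(x, G)`. -/
lemma IsSuitable.joint_hit (h : IsSuitable μ) {f : E d × SmallSet d → ℝ}
    (hf : Measurable f) :
    MeasurableSet {p : E d × SmallSet d | (p.2.carrier ∩ ball p.1 (f p)).Nonempty} := by
  have : {p : E d × SmallSet d | (p.2.carrier ∩ ball p.1 (f p)).Nonempty} = ⋃ q : ℕ × ℚ,
      ({p : E d × SmallSet d | dist (denseSeq (E d) q.1) p.1 + q.2 ≤ f p} ∩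
        Prod.snd ⁻¹' {G : SmallSet d |
          (G.carrier ∩ ball (denseSeq (E d) q.1) q.2).Nonempty}) := by
    ext p
    rw [mem_ofPred_eq, hit_ball_iff]
    simp only [mem_ofPred_eq, mem_iUnion, mem_inter_iff, mem_preimage]
  rw [this]
  refine .iUnion fun q => .inter ?_ (measurable_snd (h.hit _ _))
  exact measurableSet_le (by fun_prop) hf

lemma IsSuitable.joint_interior (h : IsSuitable μ) :
    MeasurableSet {p : E d × SmallSet d | p.1 ∈ interior p.2.carrier} := by
  simp only [mem_interior_iff_nat, ofPred_exists]
  exact .iUnion fun n => h.joint_contain measurable_const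

lemma IsSuitable.joint_closure (h : IsSuitable μ) :
    MeasurableSet {p : E d × SmallSet d | p.1 ∈ closure p.2.carrier} := by
  simp only [mem_closure_iff_nat, ofPred_forall]
  exact .iInter fun n => h.joint_hit measurable_const

lemma IsSuitable.measurableSet_interior (h : IsSuitable μ) (x : E d) :
    MeasurableSet {G : SmallSet d | x ∈ interior G.carrier} :=
  measurable_prodMk_left h.joint_interior

end Measurability

/-! ### Families of sets with prescribed diameter -/

/-- The sets `G` with `a ≤ diam G < b`. -/
def diamFam (d : ℕ) (a b : ℝ) : Set (SmallSet d) := {G | a ≤ G.diam ∧ G.diam < b}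

/-- The sets `G` with `a ≤ diam G < b` that contain the ball `B(x, ρ)`. -/
def coverFam (x : E d) (ρ a b : ℝ) : Set (SmallSet d) :=
  {G | ball x ρ ⊆ G.carrier} ∩ diamFam d a b

/-- The sets `G` with `a ≤ diam G < b` having `x` in their interior. -/
def interiorFam (x : E d) (a b : ℝ) : Set (SmallSet d) :=
  {G | x ∈ interior G.carrier} ∩ diamFam d a b

/-- The sets `G` with `a ≤ diam G < b` such that `x` lies in the open set of all points at
distance less than `ε * diam G` from `G`. -/
def nearFam (ε : ℝ) (x : E d) (a b : ℝ) : Set (SmallSet d) :=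
  {G | (G.carrier ∩ ball x (ε * G.diam)).Nonempty} ∩ diamFam d a b

lemma coverFam_subset_interiorFam {x : E d} {ρ a b : ℝ} (hρ : 0 < ρ) :
    coverFam x ρ a b ⊆ interiorFam x a b := fun _ hG =>
  ⟨mem_interior_iff_mem_nhds.2 (Filter.mem_of_superset (ball_mem_nhds x hρ) hG.1), hG.2⟩

lemma coverFam_anti {x : E d} {ρ ρ' a b : ℝ} (h : ρ ≤ ρ') :
    coverFam x ρ' a b ⊆ coverFam x ρ a b := fun _ hG =>
  ⟨(ball_subset_ball h).trans hG.1, hG.2⟩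

lemma disjoint_diamFam {a b c e : ℝ} (h : b ≤ c) :
    Disjoint (diamFam d a b) (diamFam d c e) := by
  rw [Set.disjoint_left]
  intro G hG hG'
  linarith [hG.2, hG'.1]

lemma ediam_smul_image (s : ℝ) (A : Set (E d)) :
    Metric.ediam ((fun y => s • y) '' A) = ENNReal.ofReal |s| * Metric.ediam A := by
  have := ediam_smul₀ s A
  rw [← Set.image_smul] at this
  rw [this, ENNReal.smul_def, smul_eq_mul, ← Real.enorm_eq_ofReal_abs]
  rfl

lemma SmallSet.ediam_eq (G : SmallSet d) : Metric.ediam G.carrier = ENNReal.ofReal G.diam :=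
  (ENNReal.ofReal_toReal (G.ediam_lt_one.trans ENNReal.one_lt_top).ne).symm

lemma ball_subset_smul_image {s : ℝ} (hs : 0 < s) {A : Set (E d)} {x : E d} {r : ℝ} :
    ball x r ⊆ (fun y => s⁻¹ • y) '' A ↔ ball (s • x) (s * r) ⊆ A := by
  have h1 : ball (s • x) (s * r) = (fun y => s • y) '' ball x r := by
    have := smul_ball hs.ne' x r
    rw [← Set.image_smul, Real.norm_eq_abs, abs_of_pos hs] at this
    exact this.symm
  rw [h1]
  constructor
  · rintro h _ ⟨y, hy, rfl⟩
    obtain ⟨z, hz, rfl⟩ := h hy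
    simpa [smul_smul, hs.ne'] using hz
  · intro h y hy
    exact ⟨s • y, h ⟨y, hy, rfl⟩, by simp [smul_smul, hs.ne']⟩

lemma hit_smul_image {s : ℝ} (hs : 0 < s) {A : Set (E d)} {x : E d} {r : ℝ} :
    ((fun y => s⁻¹ • y) '' A ∩ ball x r).Nonempty ↔ (A ∩ ball (s • x) (s * r)).Nonempty := by
  have h1 : ball (s • x) (s * r) = (fun y => s • y) '' ball x r := by
    have := smul_ball hs.ne' x r
    rw [← Set.image_smul, Real.norm_eq_abs, abs_of_pos hs] at this
    exact this.symm
  rw [h1]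
  constructor
  · rintro ⟨_, ⟨y, hy, rfl⟩, hyb⟩
    exact ⟨y, hy, _, hyb, by simp [smul_smul, hs.ne']⟩
  · rintro ⟨_, hy, z, hz, rfl⟩
    exact ⟨z, ⟨_, hy, by simp [smul_smul, hs.ne']⟩, hz⟩

lemma mem_diamFam_scale {s : ℝ} (hs : 0 < s) {a b : ℝ} {G H : SmallSet d}
    (h : H.diam = s⁻¹ * G.diam) : H ∈ diamFam d a b ↔ G ∈ diamFam d (s * a) (s * b) := by
  simp only [diamFam, mem_ofPred_eq, h]
  rw [← div_eq_inv_mul, le_div_iff₀ hs, div_lt_iff₀ hs, mul_comm a, mul_comm b]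

lemma scale_small {s : ℝ} (hs : 0 < s) {a b : ℝ} (hb : b ≤ 1) {G : SmallSet d}
    (h : G ∈ diamFam d (s * a) (s * b)) : s⁻¹ * G.diam < 1 := by
  rw [← div_eq_inv_mul, div_lt_one hs]
  nlinarith [h.2]

section Families

variable [MeasurableSpace (SmallSet d)] {μ : Measure (SmallSet d)}

lemma IsSuitable.measurableSet_diamFam (h : IsSuitable μ) (a b : ℝ) :
    MeasurableSet (diamFam d a b) :=
  (h.measurableSet_le_diam a).inter (h.measurableSet_diam_lt b)

lemma IsSuitable.measurableSet_coverFam (h : IsSuitable μ) (x : E d) (ρ a b : ℝ) :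
    MeasurableSet (coverFam x ρ a b) :=
  (h.contain x ρ).inter (h.measurableSet_diamFam a b)

lemma IsSuitable.measurableSet_interiorFam (h : IsSuitable μ) (x : E d) (a b : ℝ) :
    MeasurableSet (interiorFam x a b) :=
  (h.measurableSet_interior x).inter (h.measurableSet_diamFam a b)

lemma IsSuitable.joint_nearFam (h : IsSuitable μ) (ε a b : ℝ) :
    MeasurableSet {p : E d × SmallSet d | p.2 ∈ nearFam ε p.1 a b} :=
  (h.joint_hit ((h.measurable_diam.comp measurable_snd).const_mul ε)).inter
    (measurable_snd (h.measurableSet_diamFam a b))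

lemma IsSuitable.measurableSet_nearFam (h : IsSuitable μ) (ε : ℝ) (x : E d) (a b : ℝ) :
    MeasurableSet (nearFam ε x a b) :=
  measurable_prodMk_left (h.joint_nearFam ε a b)

lemma LocallyFinite.measure_lt_top (h1 : LocallyFinite μ) {a : ℝ} (ha : 0 < a) {r : ℝ}
    {x : E d} {D : Set (SmallSet d)} (hD : D ⊆ {G | a ≤ G.diam})
    (hD' : D ⊆ {G | (G.carrier ∩ ball x r).Nonempty}) : μ D < ∞ :=
  (measure_mono (fun _ hG => And.intro (hD' hG) (hD hG))).trans_lt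
    (h1 (ball x r) a isBounded_ball ha)

lemma LocallyFinite.nearFam_lt_top (h1 : LocallyFinite μ) {a b ε : ℝ} (ha : 0 < a)
    (hε : ε ≤ 1) (x : E d) : μ (nearFam ε x a b) < ∞ := by
  refine h1.measure_lt_top (x := x) (r := 1) ha (fun G hG => hG.2.1) fun G hG => ?_
  refine hG.1.mono (inter_subset_inter_right _ (ball_subset_ball ?_))
  nlinarith [G.diam_nonneg, G.diam_lt_one]

lemma LocallyFinite.interiorFam_lt_top (h1 : LocallyFinite μ) {a b : ℝ} (ha : 0 < a)
    (x : E d) : μ (interiorFam x a b) < ∞ :=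
  h1.measure_lt_top (x := x) (r := 1) ha (fun _ hG => hG.2.1) fun _ hG =>
    ⟨x, interior_subset hG.1, by simp⟩

lemma LocallyFinite.coverFam_lt_top (h1 : LocallyFinite μ) {ρ a b : ℝ} (hρ : 0 < ρ) (ha : 0 < a)
    (x : E d) : μ (coverFam x ρ a b) < ∞ :=
  (measure_mono (coverFam_subset_interiorFam hρ)).trans_lt (h1.interiorFam_lt_top ha x)

/-! ### Invariance under translations and dilations -/

lemma IsSuitable.measurable_translate (h : IsSuitable μ) (x : E d) :
    Measurable (SmallSet.translate x) := by
  intro D hD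
  convert h.translate_image (-x) D hD using 1
  ext G
  constructor
  · intro hG
    refine ⟨_, hG, ?_⟩
    simpa using SmallSet.translate_translate_neg (-x) G
  · rintro ⟨H, hH, rfl⟩
    rw [mem_preimage, SmallSet.translate_translate_neg]
    exact hH

lemma TranslationInvariant.measurePreserving (htrans : TranslationInvariant μ)
    (h : IsSuitable μ) (x : E d) : MeasurePreserving (SmallSet.translate x) μ μ := by
  refine ⟨h.measurable_translate x, ?_⟩
  ext D hD
  rw [Measure.map_apply (h.measurable_translate x) hD, ← htrans x]
  · congr 1
    ext G
    constructor
    · rintro ⟨H, hH, rfl⟩; exact hH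
    · intro hG
      refine ⟨G.translate (-x), ?_, SmallSet.translate_translate_neg x G⟩
      rwa [mem_preimage, SmallSet.translate_translate_neg]
  · exact h.measurable_translate x hD

lemma TranslationInvariant.coverFam_eq (htrans : TranslationInvariant μ) (h : IsSuitable μ)
    (x : E d) (ρ a b : ℝ) : μ (coverFam x ρ a b) = μ (coverFam 0 ρ a b) := by
  rw [← (htrans.measurePreserving h x).measure_preimage
    (h.measurableSet_coverFam x ρ a b).nullMeasurableSet]
  congr 1
  ext G
  simp only [coverFam, diamFam, mem_preimage, mem_inter_iff, mem_ofPred_eq,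
    SmallSet.ball_subset_translate, SmallSet.diam_translate, sub_self]

lemma TranslationInvariant.interiorFam_eq (htrans : TranslationInvariant μ) (h : IsSuitable μ)
    (x : E d) (a b : ℝ) : μ (interiorFam x a b) = μ (interiorFam 0 a b) := by
  rw [← (htrans.measurePreserving h x).measure_preimage
    (h.measurableSet_interiorFam x a b).nullMeasurableSet]
  congr 1
  ext G
  simp only [interiorFam, diamFam, mem_preimage, mem_inter_iff, mem_ofPred_eq,
    SmallSet.mem_interior_translate, SmallSet.diam_translate, sub_self]

lemma TranslationInvariant.nearFam_eq (htrans : TranslationInvariant μ) (h : IsSuitable μ)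
    (ε : ℝ) (x : E d) (a b : ℝ) : μ (nearFam ε x a b) = μ (nearFam ε 0 a b) := by
  rw [← (htrans.measurePreserving h x).measure_preimage
    (h.measurableSet_nearFam ε x a b).nullMeasurableSet]
  congr 1
  ext G
  simp only [nearFam, diamFam, mem_preimage, mem_inter_iff, mem_ofPred_eq,
    SmallSet.hit_translate, SmallSet.diam_translate, sub_self]

/-- The semi scale invariance, for a family `D'` that is recognised as the dilate of `D` by means
of the membership predicates. -/
lemma SemiScaleInvariant.measure_eq (hscale : SemiScaleInvariant μ) {s : ℝ} (hs : 0 < s)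
    {D D' : Set (SmallSet d)} (hD : MeasurableSet D) (hfin : μ D < ∞)
    (hsmall : ∀ H ∈ D, s * H.diam < 1) (hsmall' : ∀ G ∈ D', s⁻¹ * G.diam < 1)
    (hiff : ∀ G H : SmallSet d, H.carrier = (fun y => s⁻¹ • y) '' G.carrier →
      H.diam = s⁻¹ * G.diam → (H ∈ D ↔ G ∈ D')) : μ D' = μ D := by
  have hdiam : ∀ G H : SmallSet d, H.carrier = (fun y => s⁻¹ • y) '' G.carrier →
      H.diam = s⁻¹ * G.diam := by
    intro G H hH
    rw [SmallSet.diam, Metric.diam, hH, ediam_smul_image, ENNReal.toReal_mul,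
      ENNReal.toReal_ofReal (abs_nonneg _), abs_of_pos (inv_pos.2 hs)]
    rfl
  rw [← hscale s D hs hD hfin]
  · congr 1
    ext G
    constructor
    · intro hG
      have hlt : Metric.ediam ((fun y => s⁻¹ • y) '' G.carrier) < 1 := by
        rw [ediam_smul_image, G.ediam_eq, ← ENNReal.ofReal_mul (abs_nonneg _),
          abs_of_pos (inv_pos.2 hs), ENNReal.ofReal_lt_one]
        exact hsmall' G hG
      let H : SmallSet d := ⟨_, hlt⟩
      exact ⟨H, (hiff G H rfl (hdiam G H rfl)).2 hG, rfl⟩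
    · rintro ⟨H, hH, hHG⟩
      exact (hiff G H hHG (hdiam G H hHG)).1 hH
  · intro H hH
    rw [ediam_smul_image, H.ediam_eq, ← ENNReal.ofReal_mul (abs_nonneg _), abs_of_pos hs,
      ENNReal.ofReal_lt_one]
    exact hsmall H hH

lemma SemiScaleInvariant.coverFam_eq (hscale : SemiScaleInvariant μ) (h : IsSuitable μ)
    (h1 : LocallyFinite μ) {s ρ a b : ℝ} (hs : 0 < s) (hρ : 0 < ρ) (ha : 0 < a) (hb : b ≤ 1)
    (hsb : s * b ≤ 1) :
    μ (coverFam (0 : E d) (s * ρ) (s * a) (s * b)) = μ (coverFam (0 : E d) ρ a b) := by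
  refine hscale.measure_eq hs (h.measurableSet_coverFam _ _ _ _) (h1.coverFam_lt_top hρ ha _)
    (fun H hH => by nlinarith [hH.2.2]) (fun G hG => scale_small hs hb hG.2)
    fun G H hGH hdiam => ?_
  rw [coverFam, coverFam, mem_inter_iff, mem_inter_iff, mem_diamFam_scale hs hdiam,
    mem_ofPred_eq, mem_ofPred_eq, hGH, ball_subset_smul_image hs, smul_zero]

lemma SemiScaleInvariant.nearFam_eq (hscale : SemiScaleInvariant μ) (h : IsSuitable μ)
    (h1 : LocallyFinite μ) {s ε a b : ℝ} (hs : 0 < s) (hε : ε ≤ 1) (ha : 0 < a) (hb : b ≤ 1)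
    (hsb : s * b ≤ 1) :
    μ (nearFam ε (0 : E d) (s * a) (s * b)) = μ (nearFam ε (0 : E d) a b) := by
  refine hscale.measure_eq hs (h.measurableSet_nearFam _ _ _ _) (h1.nearFam_lt_top ha hε _)
    (fun H hH => by nlinarith [hH.2.2]) (fun G hG => scale_small hs hb hG.2)
    fun G H hGH hdiam => ?_
  rw [nearFam, nearFam, mem_inter_iff, mem_inter_iff, mem_diamFam_scale hs hdiam,
    mem_ofPred_eq, mem_ofPred_eq, hGH, hdiam, hit_smul_image hs, smul_zero]
  rw [show s * (ε * (s⁻¹ * G.diam)) = ε * G.diam by field_simp]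

lemma SemiScaleInvariant.interiorFam_eq (hscale : SemiScaleInvariant μ) (h : IsSuitable μ)
    (h1 : LocallyFinite μ) {s a b : ℝ} (hs : 0 < s) (ha : 0 < a) (hb : b ≤ 1)
    (hsb : s * b ≤ 1) :
    μ (interiorFam (0 : E d) (s * a) (s * b)) = μ (interiorFam (0 : E d) a b) := by
  refine hscale.measure_eq hs (h.measurableSet_interiorFam _ _ _) (h1.interiorFam_lt_top ha _)
    (fun H hH => by nlinarith [hH.2.2]) (fun G hG => scale_small hs hb hG.2)
    fun G H hGH hdiam => ?_
  rw [interiorFam, interiorFam, mem_inter_iff, mem_inter_iff, mem_diamFam_scale hs hdiam,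
    mem_ofPred_eq, mem_ofPred_eq, hGH, mem_interior_iff_mem_nhds, mem_interior_iff_mem_nhds,
    Metric.mem_nhds_iff, Metric.mem_nhds_iff]
  refine and_congr_left fun _ => ⟨?_, ?_⟩
  · rintro ⟨ε, hε, hb⟩
    exact ⟨s * ε, by positivity, by simpa using (ball_subset_smul_image hs).1 hb⟩
  · rintro ⟨ε, hε, hb⟩
    refine ⟨s⁻¹ * ε, by positivity, (ball_subset_smul_image hs).2 ?_⟩
    rwa [smul_zero, mul_inv_cancel_left₀ hs.ne']

end Families

/-! ### The mass of the sets having the origin in their interior -/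

/-- The mass of the sets with `1/2 ≤ diam G < 1` having the origin in their interior. -/
def unitMass [MeasurableSpace (SmallSet d)] (μ : Measure (SmallSet d)) : ℝ≥0∞ :=
  μ (interiorFam 0 (1 / 2) 1)

lemma SmallSet.volume_lt_top (G : SmallSet d) : volume G.carrier < ∞ := G.isBounded.measure_lt_top

lemma SmallSet.nonempty_of_diam_pos {G : SmallSet d} (h : 0 < G.diam) : G.carrier.Nonempty := by
  by_contra hG
  rw [Set.not_nonempty_iff_eq_empty] at hG
  simp [SmallSet.diam, hG] at h

lemma SmallSet.diam_pos_of_interior (hd : 0 < d) {G : SmallSet d} {x : E d}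
    (hx : x ∈ interior G.carrier) : 0 < G.diam := by
  have : Nonempty (Fin d) := ⟨⟨0, hd⟩⟩
  have : Nontrivial (E d) := inferInstance
  obtain ⟨ε, hε, hb⟩ := Metric.isOpen_iff.1 isOpen_interior x hx
  have hne : (ball x ε).Nontrivial := by
    apply (infinite_of_mem_nhds x (ball_mem_nhds x hε)).nontrivial
  obtain ⟨y, hy, z, hz, hyz⟩ := hne
  exact (dist_pos.2 hyz).trans_le
    (G.dist_le_diam (interior_subset (hb hy)) (interior_subset (hb hz)))

/-- An interior point `x` of `G` such that `B(x, r)` is not contained in `G` has distance less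
than `r` to the boundary of `G`. -/
lemma SmallSet.mem_innerNhd {G : SmallSet d} {x : E d} {r : ℝ} (hx : x ∈ interior G.carrier)
    (hr : ¬ ball x r ⊆ G.carrier) : x ∈ G.innerNhd r := by
  refine ⟨interior_subset hx, ?_⟩
  obtain ⟨y, hy, hyG⟩ := Set.not_subset.1 hr
  have hconn : IsPreconnected (segment ℝ x y) := (convex_segment x y).isPreconnected
  obtain ⟨z, hz, hzf⟩ : (segment ℝ x y ∩ frontier G.carrier).Nonempty := by
    by_contra hemp
    rw [Set.not_nonempty_iff_eq_empty] at hemp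
    have hsub : segment ℝ x y ⊆ interior G.carrier ∪ (closure G.carrier)ᶜ := by
      intro z hz
      by_contra hcon
      simp only [mem_union, mem_compl_iff, not_or, not_not] at hcon
      have : z ∈ segment ℝ x y ∩ frontier G.carrier := ⟨hz, hcon.2, hcon.1⟩
      rw [hemp] at this
      exact this
    have hyc : y ∈ (closure G.carrier)ᶜ := by
      rcases hsub (right_mem_segment ℝ x y) with h | h
      · exact absurd (interior_subset h) hyG
      · exact h
    obtain ⟨z, -, hz1, hz2⟩ := hconn _ _ isOpen_interior isClosed_closure.isOpen_compl hsub
      ⟨x, left_mem_segment ℝ x y, hx⟩ ⟨y, right_mem_segment ℝ x y, hyc⟩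
    exact hz2 (subset_closure (interior_subset hz1))
  calc Metric.infEDist x (frontier G.carrier) ≤ edist x z := Metric.infEDist_le_edist_of_mem hzf
    _ < ENNReal.ofReal r := by
      rw [edist_dist]
      have hr0 : 0 < r := dist_nonneg.trans_lt hy
      refine (ENNReal.ofReal_lt_ofReal_iff hr0).2 ?_
      have hyx : y ∈ ball x r := hy
      have := (convex_ball x r).segment_subset (mem_ball_self hr0) hyx hz
      rwa [dist_comm]

section

variable [MeasurableSpace (SmallSet d)] {μ : Measure (SmallSet d)}

lemma LocallyFinite.unitMass_lt_top (h1 : LocallyFinite μ) : unitMass μ < ∞ :=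
  h1.interiorFam_lt_top (by norm_num) 0

lemma LocallyFinite.sigmaFinite (h1 : LocallyFinite μ) (h : IsSuitable μ) {a : ℝ} (ha : 0 < a)
    (b : ℝ) : SigmaFinite (μ.restrict (diamFam d a b)) := by
  refine ⟨⟨⟨fun n : ℕ => {G | (G.carrier ∩ ball 0 n).Nonempty} ∪ {G | G.diam < a},
    fun n => trivial, fun n => ?_, ?_⟩⟩⟩
  · rw [Measure.restrict_apply ((h.hit 0 n).union (h.measurableSet_diam_lt a))]
    refine h1.measure_lt_top ha (x := 0) (r := n) (fun G hG => hG.2.1) fun G hG => ?_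
    rcases hG.1 with hG' | hG'
    · exact hG'
    · exact absurd hG.2.1 (not_le.2 hG')
  · refine eq_univ_of_forall fun G => mem_iUnion.2 ?_
    rcases lt_or_ge G.diam a with hG | hG
    · exact ⟨0, Or.inr hG⟩
    · obtain ⟨y, hy⟩ := SmallSet.nonempty_of_diam_pos (ha.trans_le hG)
      obtain ⟨n, hn⟩ := exists_nat_gt (dist y 0)
      exact ⟨n, Or.inl ⟨y, hy, hn⟩⟩

/-- Almost no set with diameter of order one has the origin on its boundary: by translation
invariance the mass of such sets is the average over `x` of the mass of the sets with `x` on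
their boundary. -/
lemma measure_frontierFam (hsuit : IsSuitable μ) (htrans : TranslationInvariant μ)
    (h1 : LocallyFinite μ) (h2 : NullBoundary μ) :
    μ ({G | (0 : E d) ∈ frontier G.carrier} ∩ diamFam d (1 / 2) 1) = 0 := by
  have hsf := h1.sigmaFinite hsuit (a := 1 / 2) (by norm_num) 1
  set μW := μ.restrict (diamFam d (1 / 2) 1) with hμW
  have hJ : MeasurableSet {p : E d × SmallSet d | p.1 ∈ frontier p.2.carrier} :=
    hsuit.joint_closure.diff hsuit.joint_interior
  have hsec : ∀ x : E d, MeasurableSet {G : SmallSet d | x ∈ frontier G.carrier} :=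
    fun x => measurable_prodMk_left hJ
  have hconst : ∀ x : E d, μW {G | x ∈ frontier G.carrier} = μW {G | 0 ∈ frontier G.carrier} := by
    intro x
    rw [hμW, Measure.restrict_apply (hsec x), Measure.restrict_apply (hsec 0)]
    rw [← (htrans.measurePreserving hsuit x).measure_preimage
      ((hsec x).inter (hsuit.measurableSet_diamFam _ _)).nullMeasurableSet]
    congr 1
    ext G
    simp only [frontier, Set.mem_sdiff, diamFam, mem_preimage, mem_inter_iff, mem_ofPred_eq,
      SmallSet.mem_interior_translate, SmallSet.mem_closure_translate, SmallSet.diam_translate,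
      sub_self]
  have hprod : ((volume : Measure (E d)).prod μW)
      {p : E d × SmallSet d | p.1 ∈ frontier p.2.carrier} = 0 := by
    rw [Measure.prod_apply_symm hJ, lintegral_eq_zero_iff (measurable_measure_prodMk_right hJ)]
    refine Measure.absolutelyContinuous_of_le Measure.restrict_le_self ?_
    change μ {G | ¬ volume (frontier G.carrier) = 0} = 0
    simpa only [NullBoundary, pos_iff_ne_zero] using h2
  rw [Measure.prod_apply hJ] at hprod
  have : ∫⁻ _ : E d, μW {G | 0 ∈ frontier G.carrier} = 0 := by
    rw [← hprod]
    exact lintegral_congr fun x => (hconst x).symm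
  rw [lintegral_const, mul_eq_zero] at this
  rcases this with h0 | h0
  · rwa [hμW, Measure.restrict_apply (hsec 0)] at h0
  · exact absurd h0 (NeZero.ne _)

/-- The mass of the sets that come within `ε * diam G` of the origin is close to `unitMass`
for small `ε`. -/
lemma exists_nearFam_lt (hsuit : IsSuitable μ) (htrans : TranslationInvariant μ)
    (h1 : LocallyFinite μ) (h2 : NullBoundary μ) {c : ℝ≥0∞} (hc : unitMass μ < c) :
    ∃ ε : ℝ, 0 < ε ∧ ε ≤ 1 ∧ μ (nearFam ε (0 : E d) (1 / 2) 1) < c := by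
  have hanti : Antitone fun n : ℕ => nearFam ((1 / 2 : ℝ) ^ n) (0 : E d) (1 / 2) 1 := by
    intro m n hmn G hG
    refine ⟨hG.1.mono (inter_subset_inter_right _ (ball_subset_ball ?_)), hG.2⟩
    exact mul_le_mul_of_nonneg_right
      (pow_le_pow_of_le_one (by norm_num) (by norm_num) hmn) G.diam_nonneg
  have hlim := tendsto_measure_iInter_atTop (μ := μ)
    (fun n => (hsuit.measurableSet_nearFam ((1 / 2 : ℝ) ^ n) 0 (1 / 2) 1).nullMeasurableSet)
    hanti ⟨0, (h1.nearFam_lt_top (by norm_num) (by norm_num) 0).ne⟩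
  have hle : μ (⋂ n : ℕ, nearFam ((1 / 2 : ℝ) ^ n) (0 : E d) (1 / 2) 1) ≤ unitMass μ := by
    calc _ ≤ μ (interiorFam 0 (1 / 2) 1 ∪
          ({G | (0 : E d) ∈ frontier G.carrier} ∩ diamFam d (1 / 2) 1)) := by
          refine measure_mono fun G hG => ?_
          rw [mem_iInter] at hG
          have hcl : (0 : E d) ∈ closure G.carrier := by
            refine mem_closure_iff_nat.2 fun n => (hG n).1.mono
              (inter_subset_inter_right _ (ball_subset_ball ?_))
            exact mul_le_of_le_one_right (by positivity) G.diam_lt_one.le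
          by_cases hi : (0 : E d) ∈ interior G.carrier
          · exact Or.inl ⟨hi, (hG 0).2⟩
          · exact Or.inr ⟨⟨hcl, hi⟩, (hG 0).2⟩
      _ ≤ _ := (measure_union_le _ _).trans (by
          rw [measure_frontierFam hsuit htrans h1 h2, add_zero]; rfl)
  obtain ⟨n, hn⟩ := (hlim.eventually (gt_mem_nhds (hle.trans_lt hc))).exists
  exact ⟨(1 / 2) ^ n, by positivity, pow_le_one₀ (by norm_num) (by norm_num), hn⟩

/-- If `unitMass` vanished, then by invariance almost no set would contain a point of a countable
dense set in its interior, so that almost all sets would have measure zero. -/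
lemma unitMass_pos (hd : 0 < d) (hsuit : IsSuitable μ) (htrans : TranslationInvariant μ)
    (hscale : SemiScaleInvariant μ) (h1 : LocallyFinite μ) (h2 : NullBoundary μ)
    (h3 : ChargesPositiveVolume μ) : 0 < unitMass μ := by
  rw [pos_iff_ne_zero]
  intro h0
  have hlev : ∀ (n : ℕ) (x : E d),
      μ (interiorFam x ((1 / 2 : ℝ) ^ n * (1 / 2)) ((1 / 2 : ℝ) ^ n * 1)) = 0 := by
    intro n x
    rw [htrans.interiorFam_eq hsuit, hscale.interiorFam_eq hsuit h1 (by positivity)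
      (by norm_num) le_rfl (by rw [mul_one]; exact pow_le_one₀ (by norm_num) (by norm_num))]
    exact h0
  have hnull : μ ({G | 0 < volume (frontier G.carrier)} ∪ ⋃ (n : ℕ) (k : ℕ),
      interiorFam (denseSeq (E d) k) ((1 / 2 : ℝ) ^ n * (1 / 2)) ((1 / 2 : ℝ) ^ n * 1)) = 0 :=
    measure_union_null h2 (measure_iUnion_null fun n => measure_iUnion_null fun k => hlev n _)
  refine h3.ne' (measure_mono_null (fun G hG => ?_) hnull)
  by_cases hfr : 0 < volume (frontier G.carrier)
  · exact Or.inl hfr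
  right
  have hfr0 : volume (frontier G.carrier) = 0 := by simpa using hfr
  have hi : (interior G.carrier).Nonempty := by
    by_contra hemp
    rw [Set.not_nonempty_iff_eq_empty] at hemp
    have := measure_interior_of_null_frontier hfr0
    rw [hemp, measure_empty] at this
    exact hG.ne this
  obtain ⟨k, hk⟩ := (denseRange_denseSeq (E d)).exists_mem_open isOpen_interior hi
  obtain ⟨n, hn, hn'⟩ := exists_pow_le_lt (SmallSet.diam_pos_of_interior hd hk)
    G.diam_lt_one (show (0 : ℝ) < 1 / 2 by norm_num) (by norm_num)
  simp only [mem_iUnion]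
  exact ⟨n, k, hk, by rwa [← pow_succ], by rwa [mul_one]⟩

/-- The sets with `1/2 ≤ diam G < 1` having the origin in their interior, but not containing the
ball `B(0, r)`. -/
def boundaryFam (d : ℕ) (r : ℝ) : Set (SmallSet d) :=
  interiorFam 0 (1 / 2) 1 \ {G | ball 0 r ⊆ G.carrier}

lemma IsSuitable.measurable_volume_interior (h : IsSuitable μ) :
    Measurable fun G : SmallSet d => volume (interior G.carrier) :=
  measurable_measure_prodMk_right h.joint_interior

lemma indicator_eq_indicator_of_iff {α β : Type*} {s : Set α} {t : Set β} {f : α → ℝ≥0∞}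
    {g : β → ℝ≥0∞} {a : α} {b : β} (h : a ∈ s ↔ b ∈ t) (hfg : f a = g b) :
    s.indicator f a = t.indicator g b := by
  by_cases ha : a ∈ s
  · rw [indicator_of_mem ha, indicator_of_mem (h.1 ha), hfg]
  · rw [indicator_of_notMem ha, indicator_of_notMem (fun hb => ha (h.2 hb))]

/-- The mass transport principle: choosing the origin uniformly in the interior of `G` turns
the mass of the sets of which the origin is an interior point close to the boundary into the
average over `G` of the relative volume of such points. -/
lemma lintegral_boundary_ratio (hsuit : IsSuitable μ) (htrans : TranslationInvariant μ)
    (h1 : LocallyFinite μ) (r : ℝ) :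
    ∫⁻ G in interiorFam (0 : E d) (1 / 2) 1,
      volume {x | x ∈ interior G.carrier ∧ ¬ ball x r ⊆ G.carrier} /
        volume (interior G.carrier) ∂μ = μ (boundaryFam d r) := by
  have hsf := h1.sigmaFinite hsuit (a := 1 / 2) (by norm_num) 1
  set μW := μ.restrict (diamFam d (1 / 2) 1) with hμW
  have hS : MeasurableSet {p : E d × SmallSet d |
      p.1 ∈ interior p.2.carrier ∧ ¬ ball p.1 r ⊆ p.2.carrier} :=
    hsuit.joint_interior.inter (hsuit.joint_contain measurable_const).compl
  have hS0 : MeasurableSet {G : SmallSet d |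
      (0 : E d) ∈ interior G.carrier ∧ ¬ ball (0 : E d) r ⊆ G.carrier} :=
    measurable_prodMk_left hS
  have hSG : ∀ G : SmallSet d, MeasurableSet
      {x | x ∈ interior G.carrier ∧ ¬ ball x r ⊆ G.carrier} :=
    fun G => measurable_prodMk_right hS
  let v : SmallSet d → ℝ≥0∞ := fun G => (volume (interior G.carrier))⁻¹
  have hv : Measurable v := hsuit.measurable_volume_interior.inv
  let F : E d → SmallSet d → ℝ≥0∞ := fun x G =>
    {p : E d × SmallSet d | (0 : E d) ∈ interior p.2.carrier ∧
      p.1 ∈ interior p.2.carrier ∧ ¬ ball p.1 r ⊆ p.2.carrier}.indicator (fun p => v p.2) (x, G)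
  have hF : Measurable (Function.uncurry F) :=
    (hv.comp measurable_snd).indicator
      ((measurable_snd (hsuit.measurableSet_interior 0)).inter hS)
  let F' : E d → SmallSet d → ℝ≥0∞ := fun x G =>
    {p : E d × SmallSet d | -p.1 ∈ interior p.2.carrier ∧
      (0 : E d) ∈ interior p.2.carrier ∧ ¬ ball (0 : E d) r ⊆ p.2.carrier}.indicator
        (fun p => v p.2) (x, G)
  have hF' : Measurable (Function.uncurry F') := by
    refine (hv.comp measurable_snd).indicator (MeasurableSet.inter ?_ (measurable_snd hS0))
    exact (show Measurable fun p : E d × SmallSet d => (-p.1, p.2) by fun_prop)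
      hsuit.joint_interior
  have hFF' : ∀ x G, F x (G.translate x) = F' x G := by
    intro x G
    have hvol : v (G.translate x) = v G := by
      simp only [v]
      congr 1
      have : interior (G.translate x).carrier = (fun y => y - x) ⁻¹' interior G.carrier := by
        ext y; exact SmallSet.mem_interior_translate
      rw [this]
      exact (measurePreserving_sub_right volume x).measure_preimage
        isOpen_interior.measurableSet.nullMeasurableSet
    refine indicator_eq_indicator_of_iff ?_ hvol
    rw [mem_ofPred_eq, mem_ofPred_eq, SmallSet.mem_interior_translate,
      SmallSet.mem_interior_translate,
      SmallSet.ball_subset_translate, sub_self, zero_sub]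
  have hpres : ∀ x : E d, MeasurePreserving (SmallSet.translate x) μW μW := by
    intro x
    have := (htrans.measurePreserving hsuit x).restrict_preimage
      (hsuit.measurableSet_diamFam (1 / 2) 1)
    convert this using 2
    ext G
    simp [diamFam, SmallSet.diam_translate]
  calc _ = ∫⁻ G, (∫⁻ x, F x G) ∂μW := by
        rw [show interiorFam (0 : E d) (1 / 2) 1 = {G | (0 : E d) ∈ interior G.carrier} ∩
          diamFam d (1 / 2) 1 from rfl, ← Measure.restrict_restrict
          (hsuit.measurableSet_interior 0), ← lintegral_indicator (hsuit.measurableSet_interior 0)]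
        refine lintegral_congr fun G => ?_
        by_cases hG : (0 : E d) ∈ interior G.carrier
        · rw [indicator_of_mem (by exact hG), div_eq_mul_inv, mul_comm,
            ← lintegral_indicator_const (hSG G)]
          refine lintegral_congr fun x => ?_
          refine indicator_eq_indicator_of_iff ?_ rfl
          simp only [mem_ofPred_eq, hG, true_and]
        · rw [indicator_of_notMem (by exact hG)]
          simp [F, hG]
    _ = ∫⁻ x, ∫⁻ G, F x G ∂μW := (lintegral_lintegral_swap hF.aemeasurable).symm
    _ = ∫⁻ x, ∫⁻ G, F' x G ∂μW := by
        refine lintegral_congr fun x => ?_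
        have hFx : Measurable (F x) := hF.comp measurable_prodMk_left
        rw [← (hpres x).lintegral_comp hFx]
        exact lintegral_congr fun G => hFF' x G
    _ = ∫⁻ G, (∫⁻ x, F' x G) ∂μW := lintegral_lintegral_swap hF'.aemeasurable
    _ = ∫⁻ G, {G : SmallSet d | (0 : E d) ∈ interior G.carrier ∧
          ¬ ball (0 : E d) r ⊆ G.carrier}.indicator 1 G ∂μW := by
        refine lintegral_congr fun G => ?_
        by_cases hG : (0 : E d) ∈ interior G.carrier ∧ ¬ ball (0 : E d) r ⊆ G.carrier
        · rw [indicator_of_mem (by exact hG)]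
          have hneg : MeasurableSet {x : E d | -x ∈ interior G.carrier} :=
            measurable_neg isOpen_interior.measurableSet
          calc ∫⁻ x, F' x G = ∫⁻ x, {x : E d | -x ∈ interior G.carrier}.indicator
                (fun _ => v G) x := by
                refine lintegral_congr fun x => ?_
                refine indicator_eq_indicator_of_iff ?_ rfl
                simp only [mem_ofPred_eq, hG.1, hG.2, and_true, not_false_eq_true]
            _ = v G * volume {x : E d | -x ∈ interior G.carrier} :=
                lintegral_indicator_const hneg _
            _ = v G * volume (interior G.carrier) := by
                congr 1
                exact Measure.measure_preimage_neg volume _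
            _ = 1 := ENNReal.inv_mul_cancel
                (isOpen_interior.measure_pos volume ⟨0, hG.1⟩).ne'
                ((measure_mono interior_subset).trans_lt G.volume_lt_top).ne
        · rw [indicator_of_notMem (by exact hG)]
          simp only [F', indicator, mem_ofPred_eq, hG, and_false, if_false, lintegral_zero]
    _ = μ (boundaryFam d r) := by
        rw [lintegral_indicator_one hS0, hμW, Measure.restrict_apply hS0]
        congr 1
        ext G
        simp only [boundaryFam, interiorFam, mem_inter_iff, Set.mem_sdiff, mem_ofPred_eq]
        tauto

/-- The dyadic form of the integrability condition. The integral over `(0, 1)` of a function that is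
increasing in `r`, against `dr / r`, dominates the sum of its values at the powers of `1/2`. -/
lemma tsum_boundaryFam_lt_top (hsuit : IsSuitable μ) (htrans : TranslationInvariant μ)
    (h1 : LocallyFinite μ) (h2 : NullBoundary μ) (hint : BoundaryIntegrable μ) :
    ∑' i : ℕ, μ (boundaryFam d ((1 / 2 : ℝ) ^ (i + 1))) < ∞ := by
  set T := interiorFam (0 : E d) (1 / 2) 1 with hT
  let f : SmallSet d → ℝ≥0∞ := fun G => ∫⁻ r in Ioo (0 : ℝ) 1,
    ENNReal.ofReal (1 / r) * (volume (G.innerNhd r) / G.vol)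
  let g : ℕ → SmallSet d → ℝ≥0∞ := fun i G =>
    volume {x | x ∈ interior G.carrier ∧ ¬ ball x ((1 / 2 : ℝ) ^ (i + 1)) ⊆ G.carrier} /
      volume (interior G.carrier)
  have hg : ∀ i, Measurable (g i) := fun i =>
    (measurable_measure_prodMk_right (hsuit.joint_interior.inter
      (hsuit.joint_contain measurable_const).compl)).div hsuit.measurable_volume_interior
  have hTm : MeasurableSet T := hsuit.measurableSet_interiorFam _ _ _
  have hfT : ∫⁻ G in T, f G ∂μ < ∞ := by
    refine lt_of_le_of_lt ?_ hint
    refine lintegral_mono' ?_ le_rfl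
    calc μ.restrict T = (μ.restrict T).restrict T := by
          rw [Measure.restrict_restrict hTm, inter_self]
      _ ≤ (positivePart μ).restrict (annulus d 1) := by
          refine Measure.restrict_mono (fun G hG => ?_)
            (Measure.restrict_mono (fun G hG => ?_) le_rfl)
          · refine ⟨interior_subset hG.1, ?_, ?_⟩
            · have := hG.2.1
              norm_num at this ⊢
              exact this
            · simpa using hG.2.2
          · exact (isOpen_interior.measure_pos volume ⟨0, hG.1⟩).trans_le
              (measure_mono interior_subset)
  have hgf : ∀ᵐ G ∂μ.restrict T, ∑' i, g i G ≤ 2 * f G := by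
    have hfr : ∀ᵐ G ∂μ.restrict T, volume (frontier G.carrier) = 0 := by
      refine ae_restrict_of_ae ?_
      rw [ae_iff]
      simpa only [NullBoundary, pos_iff_ne_zero] using h2
    filter_upwards [hfr] with G hG
    have hvol : volume (interior G.carrier) = G.vol := measure_interior_of_null_frontier hG
    have hpiece : ∀ i : ℕ, g i G ≤ 2 * ∫⁻ r in Ioo ((1 / 2 : ℝ) ^ (i + 1)) ((1 / 2 : ℝ) ^ i),
        ENNReal.ofReal (1 / r) * (volume (G.innerNhd r) / G.vol) := by
      intro i
      calc g i G = 2 * (ENNReal.ofReal (2 ^ i) * g i G *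
            volume (Ioo ((1 / 2 : ℝ) ^ (i + 1)) ((1 / 2 : ℝ) ^ i))) := by
            rw [Real.volume_Ioo, mul_right_comm, ← ENNReal.ofReal_mul (by positivity),
              ← mul_assoc, show (2 : ℝ≥0∞) = ENNReal.ofReal 2 by simp,
              ← ENNReal.ofReal_mul (by positivity)]
            rw [show (2 : ℝ) * (2 ^ i * ((1 / 2) ^ i - (1 / 2) ^ (i + 1))) = 1 by
              rw [pow_succ, one_div, inv_pow]; field_simp; norm_num]
            simp
        _ ≤ _ := by
            gcongr
            rw [← setLIntegral_const]
            refine setLIntegral_mono' measurableSet_Ioo fun r hr => ?_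
            have hr0 : 0 < r := lt_trans (by positivity) hr.1
            refine mul_le_mul' (ENNReal.ofReal_le_ofReal ?_) ?_
            · rw [le_div_iff₀ hr0]
              have : (2 : ℝ) ^ i * r ≤ 2 ^ i * (1 / 2) ^ i := by gcongr; exact hr.2.le
              rwa [← mul_pow, show (2 : ℝ) * (1 / 2) = 1 by norm_num, one_pow] at this
            · simp only [g, hvol]
              refine ENNReal.div_le_div_right (measure_mono fun x hx => ?_) _
              exact SmallSet.mem_innerNhd hx.1
                fun hsub => hx.2 ((ball_subset_ball hr.1.le).trans hsub)
    calc ∑' i, g i G ≤ ∑' i : ℕ, 2 * ∫⁻ r in Ioo ((1 / 2 : ℝ) ^ (i + 1)) ((1 / 2 : ℝ) ^ i),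
          ENNReal.ofReal (1 / r) * (volume (G.innerNhd r) / G.vol) := ENNReal.tsum_le_tsum hpiece
      _ = 2 * ∫⁻ r in ⋃ i : ℕ, Ioo ((1 / 2 : ℝ) ^ (i + 1)) ((1 / 2 : ℝ) ^ i),
          ENNReal.ofReal (1 / r) * (volume (G.innerNhd r) / G.vol) := by
          rw [ENNReal.tsum_mul_left, lintegral_iUnion (fun i => measurableSet_Ioo)]
          exact (pow_right_anti₀ (by norm_num) (by norm_num)).pairwise_disjoint_on_Ioo_succ
      _ ≤ 2 * f G := by
          refine mul_le_mul_right (lintegral_mono_set ?_) _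
          exact iUnion_subset fun i => Ioo_subset_Ioo (by positivity)
            (pow_le_one₀ (by norm_num) (by norm_num))
  calc ∑' i : ℕ, μ (boundaryFam d ((1 / 2 : ℝ) ^ (i + 1))) = ∑' i, ∫⁻ G in T, g i G ∂μ :=
        tsum_congr fun i => (lintegral_boundary_ratio hsuit htrans h1 _).symm
    _ = ∫⁻ G in T, ∑' i, g i G ∂μ := (lintegral_tsum fun i => (hg i).aemeasurable).symm
    _ ≤ ∫⁻ G in T, 2 * f G ∂μ := lintegral_mono_ae hgf
    _ = 2 * ∫⁻ G in T, f G ∂μ := lintegral_const_mul' _ _ (by simp)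
    _ < ∞ := ENNReal.mul_lt_top (by simp) hfT

end

/-! ### Void events of a Poisson process -/

section Void

variable {Ω S : Type*}

/-- The event that no point of `Φ` lies in `A`. -/
def PointProcess.void (Φ : PointProcess Ω S) (A : Set S) : Set Ω :=
  {ω | ∀ n : ℕ, (n : ℕ∞) < Φ.total ω → Φ.point n ω ∉ A}

lemma PointProcess.void_anti (Φ : PointProcess Ω S) {A B : Set S} (h : A ⊆ B) :
    Φ.void B ⊆ Φ.void A := fun _ hω n hn hA => hω n hn (h hA)

lemma PointProcess.void_union (Φ : PointProcess Ω S) (A B : Set S) :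
    Φ.void (A ∪ B) = Φ.void A ∩ Φ.void B := by
  ext ω
  simp only [PointProcess.void, mem_ofPred_eq, mem_inter_iff, mem_union, not_or]
  exact ⟨fun h => ⟨fun n hn => (h n hn).1, fun n hn => (h n hn).2⟩,
    fun h n hn => ⟨h.1 n hn, h.2 n hn⟩⟩

lemma PointProcess.mem_void_iff (Φ : PointProcess Ω S) (A : Set S) (ω : Ω) :
    ω ∈ Φ.void A ↔ Φ.count A ω = 0 := by
  rw [PointProcess.count, Set.encard_eq_zero, Set.eq_empty_iff_forall_notMem]
  simp only [PointProcess.void, mem_ofPred_eq, not_and]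

/-- The σ-algebra generated by the void events of subsets of `L` of finite intensity. -/
@[reducible]
def PointProcess.voidSigma [MeasurableSpace S] (Φ : PointProcess Ω S) (ν : Measure S)
    (L : Set S) : MeasurableSpace Ω :=
  MeasurableSpace.generateFrom
    {V | ∃ D : Set S, MeasurableSet D ∧ D ⊆ L ∧ ν D ≠ ∞ ∧ Φ.void D = V}

lemma PointProcess.voidSigma_mono [MeasurableSpace S] {Φ : PointProcess Ω S}
    {ν : Measure S} {L L' : Set S} (h : L ⊆ L') :
    Φ.voidSigma ν L ≤ Φ.voidSigma ν L' := by
  refine MeasurableSpace.generateFrom_mono ?_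
  rintro _ ⟨D, hD, hDL, hfin, rfl⟩
  exact ⟨D, hD, hDL.trans h, hfin, rfl⟩

lemma PointProcess.measurableSet_voidSigma [MeasurableSpace S] {Φ : PointProcess Ω S}
    {ν : Measure S} {L D : Set S} (hD : MeasurableSet D) (hDL : D ⊆ L)
    (hfin : ν D ≠ ∞) : MeasurableSet[Φ.voidSigma ν L] (Φ.void D) :=
  MeasurableSpace.measurableSet_generateFrom ⟨D, hD, hDL, hfin, rfl⟩

variable [MeasurableSpace Ω] [MeasurableSpace S] {P : Measure Ω} {ν : Measure S}
  {Φ : PointProcess Ω S}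

lemma IsPoissonProcess.measurableSet_void_prod {X : Type*} [MeasurableSpace X]
    (h : IsPoissonProcess P ν Φ) {F : X → Set S}
    (hF : MeasurableSet {p : X × S | p.2 ∈ F p.1}) :
    MeasurableSet {p : Ω × X | p.1 ∈ Φ.void (F p.2)} := by
  have heq : {p : Ω × X | p.1 ∈ Φ.void (F p.2)} =
      ⋂ n : ℕ, ({p : Ω × X | (n : ℕ∞) < Φ.total p.1}ᶜ ∪
        {p : Ω × X | Φ.point n p.1 ∈ F p.2}ᶜ) := by
    ext p
    simp only [PointProcess.void, mem_ofPred_eq, mem_iInter, mem_union, mem_compl_iff,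
      imp_iff_not_or]
  rw [heq]
  refine .iInter fun n => .union ?_ ?_
  · have hm : Measurable fun p : Ω × X => Φ.total p.1 := h.measurable_total.comp measurable_fst
    exact (hm (MeasurableSet.of_discrete (s := Ioi (n : ℕ∞)))).compl
  · have hm : Measurable fun p : Ω × X => (p.2, Φ.point n p.1) :=
      measurable_snd.prodMk ((h.measurable_point n).comp measurable_fst)
    exact (hm hF).compl

lemma IsPoissonProcess.measurableSet_void (h : IsPoissonProcess P ν Φ) {A : Set S}
    (hA : MeasurableSet A) : MeasurableSet (Φ.void A) := by
  have h1 := h.measurableSet_void_prod (X := Unit) (F := fun _ => A) (measurable_snd hA)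
  exact (measurable_id.prodMk measurable_const : Measurable fun ω : Ω => (ω, ())) h1

lemma IsPoissonProcess.voidSigma_le (h : IsPoissonProcess P ν Φ) (L : Set S) :
    Φ.voidSigma ν L ≤ (inferInstance : MeasurableSpace Ω) := by
  refine MeasurableSpace.generateFrom_le ?_
  rintro _ ⟨D, hD, -, -, rfl⟩
  exact h.measurableSet_void hD

lemma IsPoissonProcess.measure_void (h : IsPoissonProcess P ν Φ) {A : Set S}
    (hA : MeasurableSet A) (hfin : ν A ≠ ∞) :
    P (Φ.void A) = ENNReal.ofReal (Real.exp (-(ν A).toReal)) := by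
  have h1 : Φ.void A = {ω | Φ.count A ω = 0} := by
    ext ω; exact Φ.mem_void_iff A ω
  have h0 : MeasurableSet {k : ℕ∞ | k = 0} := measurableSet_singleton 0
  rw [h1, (h.count_law A hA hfin).measure_eq h0, Measure.map_apply .of_discrete h0]
  have h2 : (Nat.cast : ℕ → ℕ∞) ⁻¹' {x | x = 0} = {0} := by ext; simp
  rw [h2, poissonMeasure_singleton]
  simp [ENNReal.coe_toNNReal_eq_toReal]

/-- A void event is independent of the process restricted to a disjoint set. Since the void
events are stable under intersections, this follows from the void probabilities alone. -/
lemma IsPoissonProcess.measure_inter_void [IsProbabilityMeasure P] (h : IsPoissonProcess P ν Φ)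
    {L D : Set S} (hD : MeasurableSet D) (hfin : ν D ≠ ∞) (hdisj : Disjoint L D) {A : Set Ω}
    (hA : MeasurableSet[Φ.voidSigma ν L] A) :
    P (A ∩ Φ.void D) = P A * P (Φ.void D) := by
  have hind : Indep (Φ.voidSigma ν L) (MeasurableSpace.generateFrom {Φ.void D}) P := by
    refine IndepSets.indep (h.voidSigma_le L)
      (MeasurableSpace.generateFrom_le ?_) ?_ (IsPiSystem.singleton _) rfl rfl ?_
    · rintro _ rfl
      exact h.measurableSet_void hD
    · rintro _ ⟨D₁, hD₁, hL₁, hf₁, rfl⟩ _ ⟨D₂, hD₂, hL₂, hf₂, rfl⟩ -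
      exact ⟨D₁ ∪ D₂, hD₁.union hD₂, union_subset hL₁ hL₂,
        measure_union_ne_top hf₁ hf₂, Φ.void_union _ _⟩
    · rw [IndepSets_iff]
      rintro _ _ ⟨D₁, hD₁, hL₁, hf₁, rfl⟩ rfl
      rw [← Φ.void_union, h.measure_void (hD₁.union hD) (measure_union_ne_top hf₁ hfin),
        h.measure_void hD₁ hf₁, h.measure_void hD hfin, ← ENNReal.ofReal_mul (by positivity),
        ← Real.exp_add, measure_union (hdisj.mono_left hL₁) hD,
        ENNReal.toReal_add hf₁ hfin, neg_add]
  exact (Indep_iff _ _ _).1 hind _ _ hA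
    (MeasurableSpace.measurableSet_generateFrom rfl)

/-- If the disjoint sets `D i` all have intensity at least `κ`, each of them contains a point
of the process with probability at least `(1 - exp (-κ)) ^ k`, independently of the process
outside of them. -/
lemma IsPoissonProcess.measure_inter_hit [IsProbabilityMeasure P] (h : IsPoissonProcess P ν Φ)
    {L : Set S} {A : Set Ω} (hA : MeasurableSet[Φ.voidSigma ν L] A) {κ : ℝ}
    (D : ℕ → Set S) (hD : ∀ i, MeasurableSet (D i)) (hfin : ∀ i, ν (D i) ≠ ∞)
    (hL : ∀ i, Disjoint L (D i)) (hdisj : Pairwise fun i j => Disjoint (D i) (D j)) (k : ℕ)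
    (hκ0 : 0 ≤ κ) (hκ : ∀ i < k, κ ≤ (ν (D i)).toReal) :
    (1 - Real.exp (-κ)) ^ k * P.real A ≤ P.real (A ∩ ⋂ i < k, (Φ.void (D i))ᶜ) := by
  have hmeas : ∀ k : ℕ, MeasurableSet[Φ.voidSigma ν (L ∪ ⋃ i < k, D i)]
      (A ∩ ⋂ i < k, (Φ.void (D i))ᶜ) := by
    intro k
    refine MeasurableSet.inter (PointProcess.voidSigma_mono subset_union_left _ hA) ?_
    refine MeasurableSet.iInter fun i => MeasurableSet.iInter fun hi => MeasurableSet.compl ?_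
    exact PointProcess.measurableSet_voidSigma (hD i)
      ((subset_iUnion₂ (s := fun (i : ℕ) (_ : i < k) => D i) i hi).trans subset_union_right)
      (hfin i)
  induction k with
  | zero => simp
  | succ k ih =>
    have ih' := ih fun i hi => hκ i (hi.trans k.lt_succ_self)
    set B := A ∩ ⋂ i < k, (Φ.void (D i))ᶜ with hB
    have hsplit : A ∩ ⋂ i < k + 1, (Φ.void (D i))ᶜ = B \ Φ.void (D k) := by
      ext ω
      simp only [hB, mem_inter_iff, mem_iInter, mem_compl_iff, Set.mem_sdiff,
        Nat.lt_succ_iff_lt_or_eq,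
        and_assoc]
      refine and_congr_right fun _ => ⟨fun h => ⟨fun i hi => h i (Or.inl hi), h k (Or.inr rfl)⟩, ?_⟩
      rintro ⟨h1, h2⟩ i (hi | rfl)
      exacts [h1 i hi, h2]
    have hdis : Disjoint (L ∪ ⋃ i < k, D i) (D k) := by
      refine Disjoint.union_left (hL k) ?_
      rw [disjoint_iUnion₂_left]
      exact fun i hi => hdisj hi.ne
    have hind := h.measure_inter_void (hD k) (hfin k) hdis (hmeas k)
    have hind' : P.real (B ∩ Φ.void (D k)) = P.real B * Real.exp (-(ν (D k)).toReal) := by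
      rw [measureReal_def, hind, ENNReal.toReal_mul, h.measure_void (hD k) (hfin k),
        ENNReal.toReal_ofReal (by positivity)]
      rfl
    have hdiff : P.real (B \ Φ.void (D k)) = P.real B - P.real (B ∩ Φ.void (D k)) := by
      have := measureReal_inter_add_sdiff (μ := P) (s := B) (h.measurableSet_void (hD k))
      linarith
    rw [hsplit, hdiff, hind']
    have he : Real.exp (-(ν (D k)).toReal) ≤ Real.exp (-κ) :=
      Real.exp_le_exp.2 (neg_le_neg (hκ k k.lt_succ_self))
    have he1 : Real.exp (-κ) ≤ 1 := Real.exp_le_one_iff.2 (neg_nonpos.2 hκ0)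
    have hB0 : 0 ≤ P.real B := measureReal_nonneg
    calc (1 - Real.exp (-κ)) ^ (k + 1) * P.real A
        = (1 - Real.exp (-κ)) * ((1 - Real.exp (-κ)) ^ k * P.real A) := by ring
      _ ≤ (1 - Real.exp (-κ)) * P.real B :=
          mul_le_mul_of_nonneg_left ih' (by linarith)
      _ ≤ P.real B - P.real B * Real.exp (-(ν (D k)).toReal) := by nlinarith

end Void

/-! ### Masses of the families of all scales -/

lemma diamFam_union {a b c : ℝ} (hab : a ≤ b) (hbc : b ≤ c) :
    diamFam d a c = diamFam d a b ∪ diamFam d b c := by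
  ext G
  simp only [diamFam, mem_ofPred_eq, mem_union]
  constructor
  · rintro ⟨h1, h2⟩
    rcases lt_or_ge G.diam b with h | h
    · exact Or.inl ⟨h1, h⟩
    · exact Or.inr ⟨h, h2⟩
  · rintro (⟨h1, h2⟩ | ⟨h1, h2⟩)
    · exact ⟨h1, h2.trans_le hbc⟩
    · exact ⟨hab.trans h1, h2⟩

section Levels

variable [MeasurableSpace (SmallSet d)] {μ : Measure (SmallSet d)}

/-- Splitting a family with `a ≤ diam G < c` at diameter `b`. -/
lemma IsSuitable.measure_inter_diamFam (h : IsSuitable μ) (S : Set (SmallSet d)) {a b c : ℝ}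
    (hab : a ≤ b) (hbc : b ≤ c) :
    μ (S ∩ diamFam d a c) = μ (S ∩ diamFam d a b) + μ (S ∩ diamFam d b c) := by
  rw [← measure_inter_add_sdiff (S ∩ diamFam d a c) (h.measurableSet_diamFam a b)]
  have hdis := disjoint_diamFam (d := d) (a := a) (e := c) (le_refl b)
  congr 2
  · rw [inter_assoc, diamFam_union hab hbc, union_inter_cancel_left]
  · rw [inter_sdiff_assoc, diamFam_union hab hbc, union_sdiff_cancel_left hdis.le_bot]

lemma half_pow_succ_le (n : ℕ) : (1 / 2 : ℝ) ^ (n + 1) ≤ (1 / 2) ^ n :=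
  pow_le_pow_of_le_one (by norm_num) (by norm_num) n.le_succ

lemma half_pow_le_one (n : ℕ) : (1 / 2 : ℝ) ^ n ≤ 1 := pow_le_one₀ (by norm_num) (by norm_num)

lemma measure_nearFam_pow (hsuit : IsSuitable μ) (htrans : TranslationInvariant μ)
    (hscale : SemiScaleInvariant μ) (h1 : LocallyFinite μ) {ε : ℝ} (hε : ε ≤ 1) (x : E d)
    (n : ℕ) : μ (nearFam ε x ((1 / 2) ^ n) 1) = n * μ (nearFam ε (0 : E d) (1 / 2) 1) := by
  rw [htrans.nearFam_eq hsuit]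
  induction n with
  | zero =>
    rw [pow_zero, Nat.cast_zero, zero_mul]
    convert measure_empty (μ := μ)
    exact eq_empty_of_forall_notMem fun G hG => hG.2.1.not_gt hG.2.2
  | succ n ih =>
    rw [nearFam, hsuit.measure_inter_diamFam _ (half_pow_succ_le n) (half_pow_le_one n)]
    change μ (nearFam ε 0 _ _) + μ (nearFam ε 0 _ _) = _
    have hs := hscale.nearFam_eq hsuit h1 (s := (1 / 2 : ℝ) ^ n) (ε := ε) (a := 1 / 2) (b := 1)
      (by positivity) hε (by norm_num) le_rfl (by rw [mul_one]; exact half_pow_le_one n)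
    rw [mul_one, ← pow_succ] at hs
    rw [ih, hs]
    push_cast
    ring

lemma measure_coverFam_pow (hsuit : IsSuitable μ) (htrans : TranslationInvariant μ)
    (hscale : SemiScaleInvariant μ) (h1 : LocallyFinite μ) {ρ : ℝ} (hρ : 0 < ρ) (x : E d)
    (n : ℕ) : μ (coverFam x ρ ((1 / 2) ^ n) 1) =
      ∑ l ∈ Finset.range n, μ (coverFam (0 : E d) (2 ^ l * ρ) (1 / 2) 1) := by
  rw [htrans.coverFam_eq hsuit]
  induction n with
  | zero =>
    rw [pow_zero, Finset.range_zero, Finset.sum_empty]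
    convert measure_empty (μ := μ)
    exact eq_empty_of_forall_notMem fun G hG => hG.2.1.not_gt hG.2.2
  | succ n ih =>
    rw [coverFam, hsuit.measure_inter_diamFam _ (half_pow_succ_le n) (half_pow_le_one n)]
    change μ (coverFam 0 ρ _ _) + μ (coverFam 0 ρ _ _) = _
    have hs := hscale.coverFam_eq hsuit h1 (s := (1 / 2 : ℝ) ^ n) (ρ := 2 ^ n * ρ) (a := 1 / 2)
      (b := 1) (by positivity) (by positivity) (by norm_num) le_rfl
      (by rw [mul_one]; exact half_pow_le_one n)
    rw [mul_one, ← pow_succ, ← mul_assoc, ← mul_pow, show (1 / 2 : ℝ) * 2 = 1 by norm_num,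
      one_pow, one_mul] at hs
    rw [ih, hs, Finset.sum_range_succ, add_comm]

/-- Up to a bounded mass, all sets of diameter at least `2⁻ⁿ` with a given point in their
interior contain the ball of radius `2 ^ c * 2⁻ⁿ` around it. This is where the integrability
condition on the boundaries enters. -/
lemma exists_unitMass_le_coverFam (hsuit : IsSuitable μ) (htrans : TranslationInvariant μ)
    (hscale : SemiScaleInvariant μ) (h1 : LocallyFinite μ) (h2 : NullBoundary μ)
    (hint : BoundaryIntegrable μ) (c : ℕ) :
    ∃ C : ℝ≥0∞, C ≠ ∞ ∧ ∀ (n : ℕ) (x : E d),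
      n * unitMass μ ≤ μ (coverFam x (2 ^ c * (1 / 2) ^ n) ((1 / 2) ^ n) 1) + C := by
  let b : ℕ → ℝ≥0∞ := fun j => μ (boundaryFam d (2 ^ c * (1 / 2 : ℝ) ^ (j + 1)))
  have hb : ∀ j, b j ≤ unitMass μ := fun j => measure_mono Set.sdiff_subset
  refine ⟨∑' j, b j, ?_, fun n x => ?_⟩
  · rw [← (ENNReal.summable (f := fun j => b (j + c))).sum_add_tsum_nat_add']
    refine ENNReal.add_ne_top.2 ⟨?_, ?_⟩
    · exact ENNReal.sum_ne_top.2 fun j _ => ((hb j).trans_lt h1.unitMass_lt_top).ne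
    · convert (tsum_boundaryFam_lt_top hsuit htrans h1 h2 hint).ne using 3 with j
      simp only [b]
      congr 2
      rw [show j + c + 1 = (j + 1) + c by ring, pow_add, mul_comm _ ((1 / 2 : ℝ) ^ c), ← mul_assoc,
        ← mul_pow, show (2 : ℝ) * (1 / 2) = 1 by norm_num, one_pow, one_mul]
  · rw [measure_coverFam_pow hsuit htrans hscale h1 (by positivity)]
    have hone : ∀ ρ : ℝ, unitMass μ ≤ μ (coverFam (0 : E d) ρ (1 / 2) 1) + μ (boundaryFam d ρ) := by
      intro ρ
      refine (measure_mono fun G hG => ?_).trans (measure_union_le _ _)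
      by_cases hb : ball 0 ρ ⊆ G.carrier
      · exact Or.inl ⟨hb, hG.2⟩
      · exact Or.inr ⟨hG, hb⟩
    calc (n : ℝ≥0∞) * unitMass μ = ∑ l ∈ Finset.range n, unitMass μ := by simp
      _ ≤ ∑ l ∈ Finset.range n,
          (μ (coverFam (0 : E d) (2 ^ l * (2 ^ c * (1 / 2) ^ n)) (1 / 2) 1) + b (n - 1 - l)) := by
          refine Finset.sum_le_sum fun l hl => ?_
          rw [Finset.mem_range] at hl
          have : (2 : ℝ) ^ l * (2 ^ c * (1 / 2) ^ n) = 2 ^ c * (1 / 2) ^ (n - 1 - l + 1) := by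
            have hn : n = (n - 1 - l + 1) + l := by omega
            conv_lhs => rw [hn]
            rw [pow_add _ _ l, one_div, inv_pow, inv_pow]
            field_simp
          simp only [b]
          rw [← this]
          exact hone _
      _ ≤ _ := by
          rw [Finset.sum_add_distrib, Finset.sum_range_reflect]
          gcongr
          exact ENNReal.sum_le_tsum _

end Levels

/-! ### The dyadic grid -/

/-- The points `v + 2⁻ⁿ i` of the grid of mesh `2⁻ⁿ` in the unit cube with corner `v`. -/
noncomputable def gridPoint (v : E d) (n : ℕ) (i : Fin d → Fin (2 ^ n)) : E d :=
  v + WithLp.toLp 2 fun j => (1 / 2 : ℝ) ^ n * (i j : ℕ)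

lemma gridPoint_apply (v : E d) (n : ℕ) (i : Fin d → Fin (2 ^ n)) (j : Fin d) :
    gridPoint v n i j = v j + (1 / 2 : ℝ) ^ n * (i j : ℕ) := rfl

/-- The grid point of mesh `2⁻ⁿ` below a grid point of mesh `2⁻⁽ⁿ⁺ᵏ⁾`. -/
def gridParent {n k : ℕ} (i : Fin d → Fin (2 ^ (n + k))) : Fin d → Fin (2 ^ n) := fun j =>
  ⟨i j / 2 ^ k, Nat.div_lt_of_lt_mul (by rw [mul_comm, ← pow_add]; exact (i j).2)⟩

lemma norm_le_sqrt_mul {x : E d} {r : ℝ} (hr : 0 ≤ r) (h : ∀ j, |x j| ≤ r) :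
    ‖x‖ ≤ Real.sqrt d * r := by
  rw [EuclideanSpace.norm_eq]
  refine (Real.sqrt_le_sqrt (y := d * r ^ 2) ?_).trans_eq ?_
  · calc ∑ i, ‖x i‖ ^ 2 ≤ ∑ _i : Fin d, r ^ 2 :=
          Finset.sum_le_sum fun i _ => by
            have := h i
            rw [Real.norm_eq_abs]
            gcongr
      _ = d * r ^ 2 := by simp
  · rw [Real.sqrt_mul (Nat.cast_nonneg d), Real.sqrt_sq hr]

lemma dist_gridPoint_parent_le (v : E d) (n k : ℕ) (i : Fin d → Fin (2 ^ (n + k))) :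
    dist (gridPoint v (n + k) i) (gridPoint v n (gridParent i)) ≤ Real.sqrt d * (1 / 2) ^ n := by
  rw [dist_eq_norm]
  refine norm_le_sqrt_mul (by positivity) fun j => ?_
  rw [PiLp.sub_apply, gridPoint_apply, gridPoint_apply]
  have hdiv : ((i j : ℕ) : ℝ) = 2 ^ k * ((i j / 2 ^ k : ℕ) : ℝ) + ((i j % 2 ^ k : ℕ) : ℝ) := by
    exact_mod_cast (Nat.div_add_mod (i j : ℕ) (2 ^ k)).symm
  have hmod : ((i j % 2 ^ k : ℕ) : ℝ) ≤ 2 ^ k := by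
    exact_mod_cast (Nat.mod_lt _ (by positivity)).le
  have hmod0 : (0 : ℝ) ≤ ((i j % 2 ^ k : ℕ) : ℝ) := Nat.cast_nonneg _
  have hk : (1 / 2 : ℝ) ^ k * 2 ^ k = 1 := by rw [← mul_pow]; norm_num
  have hval : ((gridParent i j : ℕ) : ℝ) = ((i j / 2 ^ k : ℕ) : ℝ) := rfl
  rw [hval, hdiv, pow_add]
  have hE : v j + (1 / 2 : ℝ) ^ n * (1 / 2) ^ k *
      (2 ^ k * ((i j / 2 ^ k : ℕ) : ℝ) + ((i j % 2 ^ k : ℕ) : ℝ)) -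
      (v j + (1 / 2) ^ n * ((i j / 2 ^ k : ℕ) : ℝ)) =
      (1 / 2 : ℝ) ^ n * ((1 / 2) ^ k * ((i j % 2 ^ k : ℕ) : ℝ)) := by
    linear_combination (1 / 2 : ℝ) ^ n * ((i j / 2 ^ k : ℕ) : ℝ) * hk
  rw [hE, abs_of_nonneg (by positivity)]
  refine mul_le_of_le_one_right (by positivity) ?_
  calc (1 / 2 : ℝ) ^ k * ((i j % 2 ^ k : ℕ) : ℝ) ≤ (1 / 2) ^ k * 2 ^ k := by gcongr
    _ = 1 := hk

lemma exists_gridPoint_near (v x : E d) (h0 : ∀ j, v j ≤ x j) (h1 : ∀ j, x j < v j + 1) (n : ℕ) :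
    ∃ i, dist x (gridPoint v n i) ≤ Real.sqrt d * (1 / 2) ^ n := by
  have hn : (1 / 2 : ℝ) ^ n * 2 ^ n = 1 := by rw [← mul_pow]; norm_num
  have hpos : (0 : ℝ) < 2 ^ n := by positivity
  refine ⟨fun j => ⟨⌊2 ^ n * (x j - v j)⌋₊, ?_⟩, ?_⟩
  · rw [Nat.floor_lt (mul_nonneg hpos.le (by linarith [h0 j]))]
    push_cast
    nlinarith [h1 j]
  · rw [dist_eq_norm]
    refine norm_le_sqrt_mul (by positivity) fun j => ?_
    rw [PiLp.sub_apply, gridPoint_apply]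
    have hnn : 0 ≤ 2 ^ n * (x j - v j) := mul_nonneg hpos.le (by linarith [h0 j])
    have hf := Nat.floor_le hnn
    have hf' := Nat.lt_floor_add_one (2 ^ n * (x j - v j))
    set f : ℝ := (⌊2 ^ n * (x j - v j)⌋₊ : ℝ)
    have hE : x j - (v j + (1 / 2 : ℝ) ^ n * f) = (1 / 2) ^ n * (2 ^ n * (x j - v j) - f) := by
      linear_combination (-(x j - v j)) * hn
    change |x j - (v j + (1 / 2 : ℝ) ^ n * f)| ≤ _
    rw [hE, abs_of_nonneg (mul_nonneg (by positivity) (by linarith))]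
    exact mul_le_of_le_one_right (by positivity) (by linarith)

lemma card_gridParent_mem_le {n k : ℕ} (S : Finset (Fin d → Fin (2 ^ n))) :
    (Finset.univ.filter fun i : Fin d → Fin (2 ^ (n + k)) => gridParent i ∈ S).card ≤
      (2 ^ k) ^ d * S.card := by
  classical
  refine (Finset.card_le_mul_card_image (f := gridParent) _ ((2 ^ k) ^ d) fun a _ => ?_).trans
    (Nat.mul_le_mul_left _ (Finset.card_le_card ?_))
  · let g : (Fin d → Fin (2 ^ (n + k))) → (Fin d → Fin (2 ^ k)) := fun i j =>
      ⟨i j % 2 ^ k, Nat.mod_lt _ (by positivity)⟩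
    calc _ ≤ (Finset.univ : Finset (Fin d → Fin (2 ^ k))).card := by
          refine Finset.card_le_card_of_injOn g (fun _ _ => Finset.mem_coe.2 (Finset.mem_univ _)) ?_
          intro i hi i' hi' hgi
          simp only [Finset.coe_filter, mem_ofPred_eq] at hi hi'
          funext j
          apply Fin.ext
          have h1 : (i j : ℕ) / 2 ^ k = i' j / 2 ^ k :=
            congrArg (fun f => ((f j : Fin (2 ^ n)) : ℕ)) (hi.2.trans hi'.2.symm)
          have h2 : (i j : ℕ) % 2 ^ k = i' j % 2 ^ k :=
            congrArg (fun f => ((f j : Fin (2 ^ k)) : ℕ)) hgi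
          rw [← Nat.div_add_mod (i j : ℕ) (2 ^ k), h1, h2, Nat.div_add_mod]
      _ = (2 ^ k) ^ d := by simp
  · intro a ha
    obtain ⟨i, hi, rfl⟩ := Finset.mem_image.1 ha
    exact (Finset.mem_filter.1 hi).2

lemma exists_enumeration {α : Type*} [Nonempty α] (T : Finset α) {K : ℕ} (h : T.card ≤ K) :
    ∃ e : ℕ → α, ∀ a ∈ T, ∃ j < K, e j = a := by
  refine ⟨fun j => T.toList.getD j (Classical.arbitrary α), fun a ha => ?_⟩
  obtain ⟨j, hj, hja⟩ := List.getElem_of_mem (Finset.mem_toList.2 ha)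
  refine ⟨j, (hj.trans_le (by rw [Finset.length_toList])).trans_le h, ?_⟩
  rw [← hja]
  exact List.getD_eq_getElem _ _ hj

/-! ### Extinction at the critical intensity -/

/-- The sets of diameter at least `2⁻ⁿ` containing the ball of radius `2 ^ c * 2⁻ⁿ` around the
grid point `i` of mesh `2⁻ⁿ`. -/
def cellFam (c : ℕ) (v : E d) (n : ℕ) (i : Fin d → Fin (2 ^ n)) : Set (SmallSet d) :=
  coverFam (gridPoint v n i) (2 ^ c * (1 / 2) ^ n) ((1 / 2) ^ n) 1

lemma ball_gridPoint_subset {c k : ℕ} (hc : 2 * Real.sqrt d ≤ 2 ^ c) (hk : 1 ≤ k) (v : E d) (n : ℕ)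
    (i : Fin d → Fin (2 ^ (n + k))) :
    ball (gridPoint v (n + k) i) (2 ^ c * (1 / 2) ^ (n + k)) ⊆
      ball (gridPoint v n (gridParent i)) (2 ^ c * (1 / 2) ^ n) := by
  refine ball_subset_ball' ?_
  have h1 := dist_gridPoint_parent_le v n k i
  have h2 : (1 / 2 : ℝ) ^ (n + k) ≤ (1 / 2) ^ n * (1 / 2) := by
    rw [← pow_succ]
    exact pow_le_pow_of_le_one (by norm_num) (by norm_num) (by omega)
  have h3 : (0 : ℝ) < (1 / 2) ^ n := by positivity
  have h4 : (2 : ℝ) ^ c * (1 / 2) ^ (n + k) ≤ 2 ^ c * ((1 / 2) ^ n * (1 / 2)) := by gcongr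
  nlinarith

section Critical

variable {Ω : Type*} {Φ : PointProcess Ω (SmallSet d)}

/-- The cells of mesh `2⁻ⁿ` that are not covered, with room to spare, by a single set of `Φ` of
diameter at least `2⁻ⁿ`. -/
noncomputable def badCells (Φ : PointProcess Ω (SmallSet d)) (c : ℕ) (v : E d) (n : ℕ) (ω : Ω) :
    Finset (Fin d → Fin (2 ^ n)) := by
  classical exact Finset.univ.filter fun i => ω ∈ Φ.void (cellFam c v n i)

lemma mem_badCells {c : ℕ} {v : E d} {n : ℕ} {ω : Ω} {i : Fin d → Fin (2 ^ n)} :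
    i ∈ badCells Φ c v n ω ↔ ω ∈ Φ.void (cellFam c v n i) := by
  simp [badCells]

/-- The event that there are bad cells of mesh `2⁻ⁿ`. -/
def survival (Φ : PointProcess Ω (SmallSet d)) (c : ℕ) (v : E d) (n : ℕ) : Set Ω :=
  {ω | (badCells Φ c v n ω).Nonempty}

lemma cellFam_parent_subset {c k : ℕ} (hc : 2 * Real.sqrt d ≤ 2 ^ c) (hk : 1 ≤ k) (v : E d) (n : ℕ)
    (i : Fin d → Fin (2 ^ (n + k))) : cellFam c v n (gridParent i) ⊆ cellFam c v (n + k) i :=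
  fun _ hG => ⟨(ball_gridPoint_subset hc hk v n i).trans hG.1,
    (pow_le_pow_of_le_one (by norm_num) (by norm_num) (by omega)).trans hG.2.1, hG.2.2⟩

lemma gridParent_mem_badCells {c k : ℕ} (hc : 2 * Real.sqrt d ≤ 2 ^ c) (hk : 1 ≤ k) {v : E d}
    {n : ℕ}
    {ω : Ω} {i : Fin d → Fin (2 ^ (n + k))} (hi : i ∈ badCells Φ c v (n + k) ω) :
    gridParent i ∈ badCells Φ c v n ω :=
  mem_badCells.2 (Φ.void_anti (cellFam_parent_subset hc hk v n i) (mem_badCells.1 hi))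

lemma survival_subset {c k : ℕ} (hc : 2 * Real.sqrt d ≤ 2 ^ c) (hk : 1 ≤ k) (v : E d) (n : ℕ) :
    survival Φ c v (n + k) ⊆ survival Φ c v n := by
  rintro ω ⟨i, hi⟩
  exact ⟨_, gridParent_mem_badCells hc hk hi⟩

/-- If there are no bad cells of some mesh, then the unit cube is covered. -/
lemma notMem_uncovered_of_notMem_survival (hd : 0 < d) {c : ℕ} (hc : 2 * Real.sqrt d ≤ 2 ^ c)
    {v : E d}
    {n : ℕ} {ω : Ω} (hω : ω ∉ survival Φ c v n) {x : E d} (h0 : ∀ j, v j ≤ x j)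
    (h1 : ∀ j, x j < v j + 1) : x ∉ uncovered Φ ω := by
  obtain ⟨i, hi⟩ := exists_gridPoint_near v x h0 h1 n
  have hgood : ω ∉ Φ.void (cellFam c v n i) := fun h => hω ⟨i, mem_badCells.2 h⟩
  simp only [PointProcess.void, mem_ofPred_eq, not_forall, not_not] at hgood
  obtain ⟨m, hm, hG⟩ := hgood
  simp only [uncovered, mem_compl_iff, mem_iUnion, not_not]
  refine ⟨m, hm, hG.1 (mem_ball.2 (hi.trans_lt ?_))⟩
  have : (0 : ℝ) < Real.sqrt d := Real.sqrt_pos.2 (by exact_mod_cast hd)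
  have h3 : (0 : ℝ) < (1 / 2) ^ n := by positivity
  nlinarith

variable [MeasurableSpace (SmallSet d)] {μ : Measure (SmallSet d)} {t : ℝ}

lemma smul_ne_top {D : Set (SmallSet d)} (h : μ D < ∞) : (ENNReal.ofReal t • μ) D ≠ ∞ := by
  rw [Measure.smul_apply, smul_eq_mul]
  exact (ENNReal.mul_lt_top ENNReal.ofReal_lt_top h).ne

lemma toReal_smul (ht : 0 < t) (D : Set (SmallSet d)) :
    ((ENNReal.ofReal t • μ) D).toReal = t * (μ D).toReal := by
  rw [Measure.smul_apply, smul_eq_mul, ENNReal.toReal_mul, ENNReal.toReal_ofReal ht.le]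

lemma cellFam_lt_top (h1 : LocallyFinite μ) (c : ℕ) (v : E d) (n : ℕ) (i : Fin d → Fin (2 ^ n)) :
    μ (cellFam c v n i) < ∞ := h1.coverFam_lt_top (by positivity) (by positivity) _

lemma IsSuitable.measurableSet_cellFam (hsuit : IsSuitable μ) (c : ℕ) (v : E d) (n : ℕ)
    (i : Fin d → Fin (2 ^ n)) : MeasurableSet (cellFam c v n i) :=
  hsuit.measurableSet_coverFam _ _ _ _

lemma measurableSet_badCells_eq (hsuit : IsSuitable μ) (h1 : LocallyFinite μ) (c : ℕ) (v : E d)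
    (n : ℕ) (S : Finset (Fin d → Fin (2 ^ n))) :
    MeasurableSet[Φ.voidSigma (ENNReal.ofReal t • μ) (diamFam d ((1 / 2) ^ n) 1)]
      {ω | badCells Φ c v n ω = S} := by
  have hm : ∀ i, MeasurableSet[Φ.voidSigma (ENNReal.ofReal t • μ) (diamFam d ((1 / 2) ^ n) 1)]
      (Φ.void (cellFam c v n i)) := fun i =>
    PointProcess.measurableSet_voidSigma (hsuit.measurableSet_coverFam _ _ _ _)
      inter_subset_right (smul_ne_top (cellFam_lt_top h1 c v n i))
  have : {ω | badCells Φ c v n ω = S} = (⋂ i ∈ S, Φ.void (cellFam c v n i)) ∩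
      ⋂ i ∈ (S : Set (Fin d → Fin (2 ^ n)))ᶜ, (Φ.void (cellFam c v n i))ᶜ := by
    ext ω
    simp only [mem_ofPred_eq, Finset.ext_iff, mem_badCells, mem_inter_iff, mem_iInter,
      mem_compl_iff, Finset.mem_coe]
    exact ⟨fun h => ⟨fun i => (h i).2, fun i hi hv => hi ((h i).1 hv)⟩,
      fun h i => ⟨fun hv => by_contra fun hi => h.2 i hi hv, h.1 i⟩⟩
  rw [this]
  refine MeasurableSet.inter ?_ ?_
  · exact MeasurableSet.iInter fun i => MeasurableSet.iInter fun _ => hm i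
  · exact MeasurableSet.iInter fun i => MeasurableSet.iInter fun _ => (hm i).compl

/-- Since the sets with the origin in their interior have positive mass, so have those containing
a sufficiently small ball. -/
lemma exists_coverFam_pos (h : unitMass μ ≠ 0) (c : ℕ) :
    ∃ k : ℕ, 1 ≤ k ∧ 0 < μ (coverFam (0 : E d) (2 * (2 ^ c * (1 / 2) ^ k)) (1 / 2) 1) := by
  by_contra! hcon
  refine h (measure_mono_null (t := ⋃ k : ℕ,
    coverFam (0 : E d) (2 * (2 ^ c * (1 / 2) ^ (k + 1))) (1 / 2) 1) (fun G hG => ?_)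
    (measure_iUnion_null fun k => le_antisymm (hcon (k + 1) (by omega)) bot_le))
  obtain ⟨n, hn⟩ := mem_interior_iff_nat.1 hG.1
  refine mem_iUnion.2 ⟨n + c, (ball_subset_ball (le_of_eq ?_)).trans hn, hG.2⟩
  have hc : (2 : ℝ) ^ c * (1 / 2) ^ c = 1 := by rw [← mul_pow]; norm_num
  rw [pow_succ, pow_add]
  linear_combination (1 / 2 : ℝ) ^ n * hc

/-- Sets containing a given ball exist, with positive mass, in each thin band of diameters. -/
lemma coverFam_thin_pos (hsuit : IsSuitable μ) (hscale : SemiScaleInvariant μ)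
    (h1 : LocallyFinite μ) {ρ θ : ℝ} (hρ : 0 < ρ) (hθ0 : 0 < θ) (hθ1 : θ < 1)
    (hpos : 0 < μ (coverFam (0 : E d) ρ (1 / 2) 1)) : 0 < μ (coverFam (0 : E d) ρ θ 1) := by
  by_contra! hcon
  have h0 : μ (coverFam (0 : E d) ρ θ 1) = 0 := le_antisymm hcon bot_le
  refine hpos.ne' (measure_mono_null (t := ⋃ j : ℕ, coverFam (0 : E d) ρ (θ ^ (j + 1)) (θ ^ j))
    (fun G hG => ?_) (measure_iUnion_null fun j => ?_))
  · obtain ⟨n, hn, hn'⟩ := exists_pow_le_lt (x := G.diam) (by linarith [hG.2.1]) hG.2.2 hθ0 hθ1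
    exact mem_iUnion.2 ⟨n, hG.1, hn, hn'⟩
  · have hj : θ ^ j ≤ 1 := pow_le_one₀ hθ0.le hθ1.le
    have hs := hscale.coverFam_eq hsuit h1 (s := θ ^ j) (ρ := (θ ^ j)⁻¹ * ρ) (a := θ) (b := 1)
      (by positivity) (by positivity) hθ0 le_rfl (by rwa [mul_one])
    rw [mul_inv_cancel_left₀ (by positivity), mul_one, ← pow_succ] at hs
    rw [hs]
    refine measure_mono_null (coverFam_anti ?_) h0
    exact le_mul_of_one_le_left hρ.le ((one_le_inv₀ (by positivity)).2 hj)

variable [MeasurableSpace Ω] {P : Measure Ω}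

lemma measurableSet_badCells (hsuit : IsSuitable μ)
    (hΦ : IsPoissonProcess P (ENNReal.ofReal t • μ) Φ) (h1 : LocallyFinite μ) (c : ℕ) (v : E d)
    (n : ℕ) (p : Finset (Fin d → Fin (2 ^ n)) → Prop) :
    MeasurableSet {ω | p (badCells Φ c v n ω)} := by
  have : {ω | p (badCells Φ c v n ω)} =
      ⋃ (S : Finset (Fin d → Fin (2 ^ n))) (_ : p S), {ω | badCells Φ c v n ω = S} := by
    ext ω
    simp
  rw [this]
  exact .iUnion fun S => .iUnion fun _ =>
    hΦ.voidSigma_le _ _ (measurableSet_badCells_eq hsuit h1 c v n S)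

/-- At the critical intensity, the expected number of bad cells is bounded. -/
lemma exists_sum_void_le (hsuit : IsSuitable μ) (htrans : TranslationInvariant μ)
    (hscale : SemiScaleInvariant μ) (h1 : LocallyFinite μ) (h2 : NullBoundary μ)
    (hint : BoundaryIntegrable μ) (ht : 0 < t) (hcrit : d * Real.log 2 ≤ t * (unitMass μ).toReal)
    (hΦ : IsPoissonProcess P (ENNReal.ofReal t • μ) Φ) (c : ℕ) :
    ∃ C : ℝ, ∀ (v : E d) (n : ℕ), ∑ i, P.real (Φ.void (cellFam c v n i)) ≤ C := by
  obtain ⟨C, hC, hle⟩ := exists_unitMass_le_coverFam hsuit htrans hscale h1 h2 hint c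
  refine ⟨Real.exp (t * C.toReal), fun v n => ?_⟩
  have hone : ∀ i, P.real (Φ.void (cellFam c v n i)) ≤
      Real.exp (t * C.toReal) * ((2 ^ n) ^ d)⁻¹ := by
    intro i
    have hfin := cellFam_lt_top h1 c v n i
    rw [measureReal_def, hΦ.measure_void (hsuit.measurableSet_cellFam _ _ _ _) (smul_ne_top hfin),
      ENNReal.toReal_ofReal (by positivity), toReal_smul ht]
    have hreal : n * (unitMass μ).toReal ≤ (μ (cellFam c v n i)).toReal + C.toReal := by
      have := ENNReal.toReal_mono (ENNReal.add_ne_top.2 ⟨hfin.ne, hC⟩) (hle n (gridPoint v n i))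
      rwa [ENNReal.toReal_mul, ENNReal.toReal_natCast, ENNReal.toReal_add hfin.ne hC] at this
    have hexp : ((2 : ℝ) ^ n) ^ d = Real.exp (n * (d * Real.log 2)) := by
      rw [← pow_mul, ← Real.rpow_natCast, Real.rpow_def_of_pos (by norm_num)]
      push_cast
      ring_nf
    rw [hexp, ← Real.exp_neg, ← Real.exp_add]
    refine Real.exp_le_exp.2 ?_
    have h3 : (n : ℝ) * (d * Real.log 2) ≤ n * (t * (unitMass μ).toReal) := by gcongr
    have h4 := mul_le_mul_of_nonneg_left hreal ht.le
    nlinarith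
  calc ∑ i, P.real (Φ.void (cellFam c v n i))
      ≤ ∑ _i : Fin d → Fin (2 ^ n), Real.exp (t * C.toReal) * ((2 ^ n) ^ d)⁻¹ :=
        Finset.sum_le_sum fun i _ => hone i
    _ = Real.exp (t * C.toReal) := by
        rw [Finset.sum_const, Finset.card_univ]
        simp only [Fintype.card_pi, Fintype.card_fin, Finset.prod_const, Finset.card_univ,
          nsmul_eq_mul]
        push_cast
        field_simp

variable [IsProbabilityMeasure P]

/-- Given at most `M` bad cells, the sets of slightly smaller diameter cover all of them with a
probability bounded below. To make the events that the subcells are covered independent, disjoint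
bands of diameters are used for different subcells. -/
lemma exists_kill (hsuit : IsSuitable μ) (htrans : TranslationInvariant μ)
    (hscale : SemiScaleInvariant μ) (h1 : LocallyFinite μ) (hm : unitMass μ ≠ 0)
    (ht : 0 < t) (hΦ : IsPoissonProcess P (ENNReal.ofReal t • μ) Φ) {c : ℕ}
    (hc : 2 * Real.sqrt d ≤ 2 ^ c) (M : ℕ) :
    ∃ k : ℕ, 1 ≤ k ∧ ∃ δ : ℝ, 0 < δ ∧ δ ≤ 1 ∧ ∀ (v : E d) (n : ℕ)
      (S : Finset (Fin d → Fin (2 ^ n))), S.card ≤ M →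
      P.real ({ω | badCells Φ c v n ω = S} ∩ survival Φ c v (n + k)) ≤
        (1 - δ) * P.real {ω | badCells Φ c v n ω = S} := by
  obtain ⟨k, hk, hpos⟩ := exists_coverFam_pos (d := d) hm c
  set K := (2 ^ k) ^ d * (M + 1) with hK
  have hKpos : 0 < K := by positivity
  -- Split the diameters `[1/2, 1)` into the `K` bands `[θ ^ (j + 1), θ ^ j)`, one for each subcell
  -- that may have to be covered.
  obtain ⟨θ, hθ0, hθ1, hθK⟩ : ∃ θ : ℝ, 0 < θ ∧ θ < 1 ∧ θ ^ K = 1 / 2 := by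
    refine ⟨(1 / 2 : ℝ) ^ ((K : ℝ)⁻¹), by positivity, ?_, ?_⟩
    · exact Real.rpow_lt_one (by norm_num) (by norm_num) (by positivity)
    · exact Real.rpow_inv_natCast_pow (by norm_num) hKpos.ne'
  have hκpos := coverFam_thin_pos hsuit hscale h1 (by positivity) hθ0 hθ1 hpos
  set ρ : ℝ := 2 ^ c * (1 / 2) ^ k with hρ
  have hρ0 : 0 < ρ := by positivity
  have hκfin : μ (coverFam (0 : E d) (2 * ρ) θ 1) < ∞ :=
    h1.coverFam_lt_top (by positivity) hθ0 _
  set κ : ℝ := t * (μ (coverFam (0 : E d) (2 * ρ) θ 1)).toReal with hκ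
  have hκ0 : 0 < κ := mul_pos ht (ENNReal.toReal_pos hκpos.ne' hκfin.ne)
  have he1 : Real.exp (-κ) < 1 := by rw [Real.exp_lt_one_iff]; linarith
  have he0 : 0 < Real.exp (-κ) := Real.exp_pos _
  refine ⟨k, hk, (1 - Real.exp (-κ)) ^ K, pow_pos (by linarith) K,
    pow_le_one₀ (by linarith) (by linarith), fun v n S hS => ?_⟩
  classical
  set T := Finset.univ.filter fun i : Fin d → Fin (2 ^ (n + k)) => gridParent i ∈ S with hT
  have hTK : T.card ≤ K := (card_gridParent_mem_le S).trans
    (Nat.mul_le_mul_left _ (hS.trans M.le_succ))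
  have : Nonempty (Fin d → Fin (2 ^ (n + k))) := ⟨fun _ => ⟨0, by positivity⟩⟩
  obtain ⟨e, he⟩ := exists_enumeration T hTK
  let D : ℕ → Set (SmallSet d) := fun j => coverFam (gridPoint v (n + k) (e j))
    ((1 / 2) ^ n * ρ) ((1 / 2) ^ n * θ ^ (j + 1)) ((1 / 2) ^ n * θ ^ j)
  have hDm : ∀ j, MeasurableSet (D j) := fun j => hsuit.measurableSet_coverFam _ _ _ _
  have hDfin : ∀ j, μ (D j) < ∞ := fun j => h1.coverFam_lt_top (by positivity) (by positivity) _
  have hθj : ∀ j : ℕ, θ ^ j ≤ 1 := fun j => pow_le_one₀ hθ0.le hθ1.le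
  have hn0 : (0 : ℝ) < (1 / 2) ^ n := by positivity
  have hn1 : (1 / 2 : ℝ) ^ n ≤ 1 := half_pow_le_one n
  have hDL : ∀ j, Disjoint (diamFam d ((1 / 2) ^ n) 1) (D j) := fun j =>
    ((disjoint_diamFam (mul_le_of_le_one_right hn0.le (hθj j))).symm).mono_right inter_subset_right
  have hDlt : ∀ i j, i < j → Disjoint (D i) (D j) := fun i j hij =>
    (disjoint_diamFam (d := d) (mul_le_mul_of_nonneg_left
      (pow_le_pow_of_le_one hθ0.le hθ1.le hij) hn0.le)).symm.mono inter_subset_right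
        inter_subset_right
  have hDdisj : Pairwise fun i j => Disjoint (D i) (D j) := fun i j hij => by
    rcases lt_or_gt_of_ne hij with h | h
    · exact hDlt i j h
    · exact (hDlt j i h).symm
  have hhalf : ∀ j ≤ K, 1 / 2 ≤ θ ^ j := fun j hj => by
    rw [← hθK]
    exact pow_le_pow_of_le_one hθ0.le hθ1.le hj
  have hDκ : ∀ j < K, κ ≤ ((ENNReal.ofReal t • μ) (D j)).toReal := by
    intro j hj
    rw [toReal_smul ht]
    refine mul_le_mul_of_nonneg_left (ENNReal.toReal_mono (hDfin j).ne ?_) ht.le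
    have hs := hscale.coverFam_eq hsuit h1 (s := (1 / 2) ^ n * θ ^ j) (ρ := (θ ^ j)⁻¹ * ρ) (a := θ)
      (b := 1) (by positivity) (by positivity) hθ0 le_rfl
      (by rw [mul_one]; exact mul_le_one₀ hn1 (by positivity) (hθj j))
    rw [mul_one, mul_assoc _ (θ ^ j) (_ * ρ), mul_inv_cancel_left₀ (by positivity), mul_assoc _ _ θ,
      ← pow_succ] at hs
    simp only [D]
    rw [htrans.coverFam_eq hsuit (gridPoint v (n + k) (e j)), hs]
    refine measure_mono (coverFam_anti (mul_le_mul_of_nonneg_right ?_ hρ0.le))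
    rw [inv_le_comm₀ (by positivity) (by norm_num)]
    linarith [hhalf j hj.le]
  have hA := measurableSet_badCells_eq (Φ := Φ) (t := t) hsuit h1 c v n S
  have hhit := hΦ.measure_inter_hit hA D hDm (fun j => smul_ne_top (hDfin j)) hDL hDdisj K
    hκ0.le hDκ
  set A := {ω | badCells Φ c v n ω = S} with hAdef
  have hdis : A ∩ survival Φ c v (n + k) ⊆ A \ (A ∩ ⋂ i < K, (Φ.void (D i))ᶜ) := by
    rintro ω ⟨hωA, i, hi⟩
    refine ⟨hωA, fun hω => ?_⟩
    have hiT : i ∈ T := by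
      rw [hT, Finset.mem_filter]
      refine ⟨Finset.mem_univ _, ?_⟩
      rw [← show badCells Φ c v n ω = S from hωA]
      exact gridParent_mem_badCells hc hk hi
    obtain ⟨j, hj, rfl⟩ := he i hiT
    have hω' := mem_iInter₂.1 hω.2 j hj
    refine hω' (Φ.void_anti (fun G hG => ?_) (mem_badCells.1 hi))
    refine ⟨?_, ?_, G.diam_lt_one⟩
    · have h2 := hG.1
      rwa [mem_ofPred_eq, hρ, mul_left_comm, ← pow_add] at h2
    · refine le_trans ?_ hG.2.1
      rw [pow_add]
      refine mul_le_mul_of_nonneg_left (le_trans ?_ (hhalf (j + 1) hj)) hn0.le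
      calc (1 / 2 : ℝ) ^ k ≤ (1 / 2) ^ 1 := pow_le_pow_of_le_one (by norm_num) (by norm_num) hk
        _ = 1 / 2 := pow_one _
  have hBm : MeasurableSet (A ∩ ⋂ i < K, (Φ.void (D i))ᶜ) :=
    (hΦ.voidSigma_le _ _ hA).inter (.iInter fun i => .iInter fun _ =>
      (hΦ.measurableSet_void (hDm i)).compl)
  calc _ ≤ P.real (A \ (A ∩ ⋂ i < K, (Φ.void (D i))ᶜ)) := measureReal_mono hdis
    _ = P.real A - P.real (A ∩ ⋂ i < K, (Φ.void (D i))ᶜ) :=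
        measureReal_sdiff inter_subset_left hBm
    _ ≤ _ := by linarith

/-- Markov's inequality for the number of bad cells. -/
lemma measure_lt_card_badCells_le (hsuit : IsSuitable μ)
    (hΦ : IsPoissonProcess P (ENNReal.ofReal t • μ) Φ) (c : ℕ) (v : E d) (n : ℕ) (M : ℕ) :
    M * P.real {ω | M < (badCells Φ c v n ω).card} ≤
      ∑ i, P.real (Φ.void (cellFam c v n i)) := by
  have hm : ∀ i, MeasurableSet (Φ.void (cellFam c v n i)) := fun i =>
    hΦ.measurableSet_void (hsuit.measurableSet_cellFam _ _ _ _)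
  have hcard : ∀ ω, ((badCells Φ c v n ω).card : ℝ≥0∞) =
      ∑ i, (Φ.void (cellFam c v n i)).indicator 1 ω := by
    intro ω
    classical
    rw [badCells, Finset.card_filter]
    push_cast
    refine Finset.sum_congr rfl fun i _ => ?_
    by_cases h : ω ∈ Φ.void (cellFam c v n i) <;> simp [h]
  have hmeas : Measurable fun ω => ((badCells Φ c v n ω).card : ℝ≥0∞) := by
    simp only [hcard]
    exact Finset.measurable_sum _ fun i _ => measurable_one.indicator (hm i)
  have h := mul_meas_ge_le_lintegral hmeas (μ := P) (M : ℝ≥0∞)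
  have hint : ∫⁻ ω, ((badCells Φ c v n ω).card : ℝ≥0∞) ∂P = ∑ i, P (Φ.void (cellFam c v n i)) := by
    simp only [hcard]
    rw [lintegral_finsetSum _ fun i _ => measurable_one.indicator (hm i)]
    exact Finset.sum_congr rfl fun i _ => lintegral_indicator_one (hm i)
  rw [hint] at h
  have h' : (M : ℝ≥0∞) * P {ω | M < (badCells Φ c v n ω).card} ≤
      ∑ i, P (Φ.void (cellFam c v n i)) := by
    refine le_trans (mul_le_mul_right (measure_mono fun ω hω => ?_) _) h
    have : M < (badCells Φ c v n ω).card := hω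
    simpa using this.le
  have h'' := ENNReal.toReal_mono
    (ENNReal.sum_ne_top.2 fun i _ => measure_ne_top P (Φ.void (cellFam c v n i))) h'
  rwa [ENNReal.toReal_mul, ENNReal.toReal_natCast,
    ENNReal.toReal_sum fun i _ => measure_ne_top P _] at h''

/-- Survival from mesh `2⁻ⁿ` to mesh `2⁻⁽ⁿ⁺ᵏ⁾`: unless there are more than `M` bad cells, all of
them are killed with probability at least `δ`, whatever the set of bad cells. -/
lemma measure_survival_add_le (hsuit : IsSuitable μ)
    (hΦ : IsPoissonProcess P (ENNReal.ofReal t • μ) Φ) (h1 : LocallyFinite μ) {c : ℕ}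
    (hc : 2 * Real.sqrt d ≤ 2 ^ c) (v : E d) (n : ℕ) {M k : ℕ} (hk : 1 ≤ k) {δ : ℝ} (hδ1 : δ ≤ 1)
    (hkill : ∀ S : Finset (Fin d → Fin (2 ^ n)), S.card ≤ M →
      P.real ({ω | badCells Φ c v n ω = S} ∩ survival Φ c v (n + k)) ≤
        (1 - δ) * P.real {ω | badCells Φ c v n ω = S}) :
    P.real (survival Φ c v (n + k)) ≤ (1 - δ) * P.real (survival Φ c v n) +
      δ * P.real {ω | M < (badCells Φ c v n ω).card} := by
  classical
  set B := {ω | M < (badCells Φ c v n ω).card} with hB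
  set 𝒮 := Finset.univ.filter fun S : Finset (Fin d → Fin (2 ^ n)) => S.Nonempty ∧ S.card ≤ M
    with h𝒮
  have hBm : MeasurableSet B := measurableSet_badCells hsuit hΦ h1 c v n fun S => M < S.card
  have hsub : survival Φ c v (n + k) ⊆
      (⋃ S ∈ 𝒮, {ω | badCells Φ c v n ω = S} ∩ survival Φ c v (n + k)) ∪ B := by
    intro ω hω
    by_cases hωB : M < (badCells Φ c v n ω).card
    · exact Or.inr hωB
    · refine Or.inl (mem_iUnion₂.2 ⟨badCells Φ c v n ω, ?_, rfl, hω⟩)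
      rw [h𝒮, Finset.mem_filter]
      exact ⟨Finset.mem_univ _, survival_subset hc hk v n hω, not_lt.1 hωB⟩
  have hdisj : P.real (⋃ S ∈ 𝒮, {ω | badCells Φ c v n ω = S}) =
      ∑ S ∈ 𝒮, P.real {ω | badCells Φ c v n ω = S} := by
    refine measureReal_biUnion_finset ?_ fun S _ =>
      measurableSet_badCells hsuit hΦ h1 c v n fun S' => S' = S
    intro S _ S' _ hSS'
    rw [Function.onFun, Set.disjoint_left]
    intro ω h h'
    exact hSS' ((show badCells Φ c v n ω = S from h).symm.trans h')
  have hsub' : (⋃ S ∈ 𝒮, {ω | badCells Φ c v n ω = S}) ⊆ survival Φ c v n \ B := by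
    intro ω hω
    obtain ⟨S, hS, hωS⟩ := mem_iUnion₂.1 hω
    have hωS' : badCells Φ c v n ω = S := hωS
    rw [h𝒮, Finset.mem_filter] at hS
    refine ⟨?_, ?_⟩
    · change (badCells Φ c v n ω).Nonempty
      rw [hωS']
      exact hS.2.1
    · change ¬ M < (badCells Φ c v n ω).card
      rw [hωS']
      exact not_lt.2 hS.2.2
  have hBsub : B ⊆ survival Φ c v n := fun ω hω =>
    Finset.card_pos.1 (lt_of_le_of_lt (Nat.zero_le M) hω)
  calc P.real (survival Φ c v (n + k))
      ≤ P.real (⋃ S ∈ 𝒮, {ω | badCells Φ c v n ω = S} ∩ survival Φ c v (n + k)) + P.real B :=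
        (measureReal_mono hsub).trans (measureReal_union_le _ _)
    _ ≤ ∑ S ∈ 𝒮, P.real ({ω | badCells Φ c v n ω = S} ∩ survival Φ c v (n + k)) + P.real B :=
        add_le_add_left (measureReal_biUnion_finset_le _ _) _
    _ ≤ ∑ S ∈ 𝒮, (1 - δ) * P.real {ω | badCells Φ c v n ω = S} + P.real B :=
        add_le_add_left (Finset.sum_le_sum fun S hS => hkill S (Finset.mem_filter.1 hS).2.2) _
    _ = (1 - δ) * P.real (⋃ S ∈ 𝒮, {ω | badCells Φ c v n ω = S}) + P.real B := by
        rw [hdisj, Finset.mul_sum]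
    _ ≤ (1 - δ) * (P.real (survival Φ c v n) - P.real B) + P.real B := by
        rw [← measureReal_sdiff hBsub hBm]
        exact add_le_add_left (mul_le_mul_of_nonneg_left (measureReal_mono hsub')
          (by linarith)) _
    _ = _ := by ring

/-- At the critical intensity bad cells die out: the number of bad cells has bounded mean, so with
high probability there are at most `M` of them, and then they all die with a probability bounded
below, at infinitely many scales. -/
lemma measure_iInter_survival (hsuit : IsSuitable μ) (htrans : TranslationInvariant μ)
    (hscale : SemiScaleInvariant μ) (h1 : LocallyFinite μ) (h2 : NullBoundary μ)
    (hint : BoundaryIntegrable μ) (ht : 0 < t) (hm : unitMass μ ≠ 0)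
    (hcrit : d * Real.log 2 ≤ t * (unitMass μ).toReal)
    (hΦ : IsPoissonProcess P (ENNReal.ofReal t • μ) Φ) {c : ℕ} (hc : 2 * Real.sqrt d ≤ 2 ^ c)
    (v : E d) : P.real (⋂ n, survival Φ c v n) = 0 := by
  have hanti : Antitone fun n => survival Φ c v n :=
    antitone_nat_of_succ_le fun n => survival_subset hc le_rfl v n
  have hlim : Tendsto (fun n => P.real (survival Φ c v n)) atTop
      (𝓝 (P.real (⋂ n, survival Φ c v n))) :=
    (ENNReal.tendsto_toReal (measure_ne_top P _)).comp (tendsto_measure_iInter_atTop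
      (fun n => (measurableSet_badCells hsuit hΦ h1 c v n
        fun S => S.Nonempty).nullMeasurableSet) hanti ⟨0, measure_ne_top P _⟩)
  set s := P.real (⋂ n, survival Φ c v n) with hs
  obtain ⟨C, hC⟩ := exists_sum_void_le hsuit htrans hscale h1 h2 hint ht hcrit hΦ c
  have hbound : ∀ M : ℕ, M * s ≤ C := by
    intro M
    obtain ⟨k, hk, δ, hδ0, hδ1, hkill⟩ := exists_kill hsuit htrans hscale h1 hm ht hΦ hc M
    have hstep : ∀ n, M * P.real (survival Φ c v (n + k)) ≤
        (1 - δ) * (M * P.real (survival Φ c v n)) + δ * C := by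
      intro n
      have ha := measure_survival_add_le hsuit hΦ h1 hc v n hk hδ1 (hkill v n)
      have hb := (measure_lt_card_badCells_le hsuit hΦ c v n M).trans (hC v n)
      have ha' := mul_le_mul_of_nonneg_left ha (Nat.cast_nonneg (α := ℝ) M)
      have hb' := mul_le_mul_of_nonneg_left hb hδ0.le
      linarith
    -- In the limit, the recursion reads `M s ≤ (1 - δ) M s + δ C`.
    have hl := le_of_tendsto_of_tendsto' (((tendsto_add_atTop_iff_nat k).2 hlim).const_mul (M : ℝ))
      (((hlim.const_mul (M : ℝ)).const_mul (1 - δ)).add_const (δ * C)) hstep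
    nlinarith
  refine le_antisymm ?_ measureReal_nonneg
  by_contra! hpos
  obtain ⟨M, hM⟩ := exists_nat_gt (C / s)
  rw [div_lt_iff₀ hpos] at hM
  linarith [hbound M]

lemma ae_uncovered_eq_empty (hd : 0 < d) (hsuit : IsSuitable μ) (htrans : TranslationInvariant μ)
    (hscale : SemiScaleInvariant μ) (h1 : LocallyFinite μ) (h2 : NullBoundary μ)
    (hint : BoundaryIntegrable μ) (ht : 0 < t) (hm : unitMass μ ≠ 0)
    (hcrit : d * Real.log 2 ≤ t * (unitMass μ).toReal)
    (hΦ : IsPoissonProcess P (ENNReal.ofReal t • μ) Φ) : ∀ᵐ ω ∂P, uncovered Φ ω = ∅ := by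
  obtain ⟨c, hc⟩ := pow_unbounded_of_one_lt (2 * Real.sqrt d) (one_lt_two (α := ℝ))
  have hall : ∀ᵐ ω ∂P, ∀ w : Fin d → ℤ,
      ω ∉ ⋂ n, survival Φ c (WithLp.toLp 2 fun j => (w j : ℝ)) n := by
    rw [ae_all_iff]
    intro w
    have := measure_iInter_survival hsuit htrans hscale h1 h2 hint ht hm hcrit hΦ hc.le
      (WithLp.toLp 2 fun j => (w j : ℝ))
    exact measure_eq_zero_iff_ae_notMem.1 ((measureReal_eq_zero_iff).1 this)
  filter_upwards [hall] with ω hω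
  refine eq_empty_of_forall_notMem fun x => ?_
  have := hω fun j => ⌊x j⌋
  rw [mem_iInter, not_forall] at this
  obtain ⟨n, hn⟩ := this
  exact notMem_uncovered_of_notMem_survival hd hc.le hn (fun j => Int.floor_le _)
    fun j => Int.lt_floor_add_one _

end Critical

/-! ### Second moment and energy estimates -/

/-- The Riesz kernel of exponent `β < d` is integrable over the square of the unit ball. -/
lemma lintegral_edist_rpow_lt_top (hd : 0 < d) {β : ℝ} (hβ : β < d) :
    ∫⁻ p in closedBall (0 : E d) 1 ×ˢ closedBall (0 : E d) 1, edist p.1 p.2 ^ (-β) < ∞ := by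
  have : Nonempty (Fin d) := ⟨⟨0, hd⟩⟩
  have hfr : Module.finrank ℝ (E d) = d := by simp
  have hint : IntegrableOn (fun z : E d => ‖z‖ ^ (-β)) (ball 0 3) := by
    refine integrableOn_ball_of_norm_le_rpow (C := 1) (α := β) (by rw [hfr]; exact hd)
      (by rw [hfr]; exact hβ) (.of_forall fun z => ?_) ?_
    · rw [one_mul, Real.norm_of_nonneg (by positivity)]
    · exact (measurable_norm.pow_const _).aestronglyMeasurable
  have hfin : ∫⁻ z in ball (0 : E d) 3, ‖z‖ₑ ^ (-β) < ∞ := by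
    refine lt_of_eq_of_lt ?_ hint.2
    refine setLIntegral_congr_fun_ae measurableSet_ball ?_
    filter_upwards [compl_mem_ae_iff.2 (measure_singleton (μ := volume) (0 : E d))] with z hz _
    have hz' : 0 < ‖z‖ := norm_pos_iff.2 hz
    rw [Real.enorm_of_nonneg (by positivity), ← ofReal_norm,
      ENNReal.ofReal_rpow_of_pos hz']
  have hmeas : Measurable fun p : E d × E d => edist p.1 p.2 ^ (-β) :=
    measurable_edist.pow_const _
  rw [Measure.volume_eq_prod, setLIntegral_prod _ hmeas.aemeasurable]
  calc ∫⁻ x in closedBall (0 : E d) 1, ∫⁻ y in closedBall (0 : E d) 1, edist x y ^ (-β)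
      ≤ ∫⁻ x in closedBall (0 : E d) 1, ∫⁻ z in ball (0 : E d) 3, ‖z‖ₑ ^ (-β) := by
        refine setLIntegral_mono' measurableSet_closedBall fun x hx => ?_
        rw [← lintegral_indicator measurableSet_closedBall,
          ← lintegral_indicator measurableSet_ball,
          ← lintegral_sub_left_eq_self _ x]
        refine lintegral_mono fun y => ?_
        by_cases hy : x - y ∈ closedBall (0 : E d) 1
        · have hyb : y ∈ ball (0 : E d) 3 := by
            rw [mem_closedBall_zero_iff] at hx hy
            rw [mem_ball_zero_iff]
            have := norm_sub_le x (x - y)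
            rw [sub_sub_cancel] at this
            linarith
          rw [indicator_of_mem hy, indicator_of_mem hyb, edist_eq_enorm_sub, sub_sub_cancel]
        · rw [indicator_of_notMem hy]
          exact bot_le
    _ < ∞ := by
        rw [setLIntegral_const]
        exact ENNReal.mul_lt_top hfin measure_closedBall_lt_top

/-- A random variable of fixed mean is bounded below with a probability bounded below, while
its square is dominated by a random variable of bounded mean that stays bounded. -/
lemma exists_measure_ge {V C D : ℝ≥0∞} (hV0 : V ≠ 0) (hV : V ≠ ∞) (hC : C ≠ ∞) (hD : D ≠ ∞) :
    ∃ M c : ℝ≥0∞, M ≠ ∞ ∧ c ≠ 0 ∧ ∀ {Ω : Type*} [MeasurableSpace Ω] (P : Measure Ω)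
      [IsProbabilityMeasure P] (X J : Ω → ℝ≥0∞), Measurable X → Measurable J →
      ∫⁻ ω, X ω ∂P = V → ∫⁻ ω, J ω ∂P ≤ C → (∀ ω, X ω ^ 2 ≤ D * J ω) →
      c ≤ P {ω | V / 2 ≤ X ω ∧ J ω ≤ M} := by
  set η : ℝ≥0∞ := V / 4 / (C + 1) with hη
  have hC1 : C + 1 ≠ ∞ := ENNReal.add_ne_top.2 ⟨hC, ENNReal.one_ne_top⟩
  have hV4 : V / 4 ≠ 0 := (ENNReal.div_pos hV0 (by norm_num)).ne'
  have hV4' : V / 4 ≠ ∞ := ENNReal.div_ne_top hV (by norm_num)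
  have hη0 : η ≠ 0 := (ENNReal.div_pos hV4 hC1).ne'
  have hη' : η ≠ ∞ := ENNReal.div_ne_top hV4' (by simp)
  have hηC : η * C ≤ V / 4 := by
    calc η * C ≤ η * (C + 1) := by gcongr; exact le_self_add
      _ = V / 4 := ENNReal.div_mul_cancel (by simp) hC1
  set M : ℝ≥0∞ := D / η ^ 2 with hM
  have hM' : M ≠ ∞ := ENNReal.div_ne_top hD (pow_ne_zero 2 hη0)
  set B : ℝ≥0∞ := D * M + 1 with hB
  have hB' : B ≠ ∞ := ENNReal.add_ne_top.2 ⟨ENNReal.mul_ne_top hD hM', ENNReal.one_ne_top⟩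
  refine ⟨M, V / 4 / B, hM', (ENNReal.div_pos hV4 hB').ne', ?_⟩
  intro Ω _ P _ X J hX hJ hXV hJC hXJ
  set A := {ω | V / 2 ≤ X ω ∧ J ω ≤ M} with hA
  have hAm : MeasurableSet A :=
    (measurableSet_le measurable_const hX).inter (measurableSet_le hJ measurable_const)
  -- Off the event `A`, either `X < V / 2` or `J > M`, and in the second case `X² ≤ D * J`
  -- together with the choice of `M` forces `X ≤ η * J`, which has small mean.
  have hpt : ∀ ω, X ω ≤ V / 2 + (A.indicator (fun _ => B) ω + η * J ω) := by
    intro ω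
    by_cases h1 : V / 2 ≤ X ω
    · by_cases h2 : J ω ≤ M
      · have hωA : ω ∈ A := ⟨h1, h2⟩
        rw [indicator_of_mem hωA]
        refine le_trans ?_ (le_add_self.trans' le_self_add)
        rcases le_total (X ω) 1 with h3 | h3
        · exact h3.trans le_add_self
        · calc X ω = X ω * 1 := (mul_one _).symm
            _ ≤ X ω * X ω := by gcongr
            _ = X ω ^ 2 := (sq _).symm
            _ ≤ D * J ω := hXJ ω
            _ ≤ D * M := by gcongr
            _ ≤ B := le_self_add
      · refine le_trans ?_ (le_add_self.trans le_add_self)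
        by_contra! h3
        have hJ' : J ω ≠ ∞ := by
          intro htop
          rw [htop, ENNReal.mul_top hη0] at h3
          exact not_top_lt h3
        have hJ0 : J ω ≠ 0 := fun h0 => h2 (by rw [h0]; exact bot_le)
        refine h2 ?_
        rw [hM, ENNReal.le_div_iff_mul_le (Or.inl (pow_ne_zero 2 hη0))
          (Or.inl (ENNReal.pow_ne_top hη'))]
        have h4 : (η * J ω) ^ 2 ≤ D * J ω := (pow_le_pow_left₀ bot_le h3.le 2).trans (hXJ ω)
        rw [← ENNReal.mul_le_mul_iff_left hJ0 hJ']
        calc J ω * η ^ 2 * J ω = (η * J ω) ^ 2 := by ring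
          _ ≤ D * J ω := h4
    · exact (not_le.1 h1).le.trans le_self_add
  have hmean : V ≤ V / 2 + (B * P A + V / 4) := by
    calc V = ∫⁻ ω, X ω ∂P := hXV.symm
      _ ≤ ∫⁻ ω, (V / 2 + (A.indicator (fun _ => B) ω + η * J ω)) ∂P := lintegral_mono hpt
      _ = V / 2 + (B * P A + η * ∫⁻ ω, J ω ∂P) := by
          rw [lintegral_add_left measurable_const,
            lintegral_add_left (measurable_const.indicator hAm), lintegral_indicator_const hAm,
            lintegral_const_mul _ hJ, lintegral_const, measure_univ, mul_one]
      _ ≤ V / 2 + (B * P A + V / 4) := by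
          gcongr
          exact (mul_le_mul_right hJC η).trans hηC
  -- Cancel `V / 2 + V / 4` on both sides.
  have hkey : V / 4 ≤ B * P A := by
    have h2 : V / 2 = V / 4 + V / 4 := by
      rw [← two_mul, ← mul_div_assoc, mul_comm 2 V, show (4 : ℝ≥0∞) = 2 * 2 by norm_num,
        ENNReal.mul_div_mul_right _ _ (by norm_num) (by norm_num)]
    have hVV : V = V / 2 + (V / 4 + V / 4) := by rw [← h2, ENNReal.add_halves]
    have hV2 : V / 2 ≠ ∞ := ENNReal.div_ne_top hV (by norm_num)
    have h3 : V / 4 + V / 4 ≤ B * P A + V / 4 := by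
      rw [← ENNReal.add_le_add_iff_left hV2, ← hVV]
      exact hmean
    exact (ENNReal.add_le_add_iff_right hV4').1 h3
  refine ENNReal.div_le_of_le_mul ?_
  rwa [mul_comm]

/-- Nested compact sets that carry measures of mass bounded below, but with uniformly little mass
near each point, do not have a countable intersection. -/
lemma exists_mem_iInter_notMem {W : ℕ → Set (E d)} (hW : ∀ n, IsCompact (W n)) (hanti : Antitone W)
    {ν : ℕ → Measure (E d)} {V : ℝ≥0∞} (hV : V ≠ 0) {good : ℕ → Prop}
    (hgood : ∃ᶠ n in atTop, good n)
    (hlow : ∀ n, good n → V ≤ ν n (W n))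
    (hsmall : ∀ z : E d, ∀ η : ℝ≥0∞, η ≠ 0 → ∃ r : ℝ, 0 < r ∧ ∀ n, good n → ν n (ball z r) ≤ η)
    {Z : Set (E d)} (hZ : Z.Countable) : ∃ x ∈ ⋂ n, W n, x ∉ Z := by
  by_contra! hcon
  have : Countable Z := hZ.to_subtype
  obtain ⟨η, hη0, hηV⟩ := ENNReal.exists_pos_sum_of_countable' hV Z
  choose r hr0 hr using fun z : Z => hsmall z (η z) (hη0 z).ne'
  obtain ⟨N, hN⟩ := exists_subset_nhds_of_isCompact (U := ⋃ z : Z, ball (z : E d) (r z))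
    hanti.directed_ge hW fun x hx =>
      mem_of_superset (ball_mem_nhds x (hr0 ⟨x, hcon x hx⟩))
        (subset_iUnion (fun z : Z => ball (z : E d) (r z)) ⟨x, hcon x hx⟩)
  obtain ⟨n, hn, hg⟩ := frequently_atTop.1 hgood N
  refine hηV.not_ge ?_
  calc V ≤ ν n (W n) := hlow n hg
    _ ≤ ν n (⋃ z : Z, ball (z : E d) (r z)) := measure_mono ((hanti hn).trans hN)
    _ ≤ ∑' z : Z, ν n (ball (z : E d) (r z)) := measure_iUnion_le _
    _ ≤ ∑' z : Z, η z := ENNReal.tsum_le_tsum fun z => hr z n hg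

/-! ### Survival below the critical intensity -/

section Subcritical

variable {Ω : Type*} {Φ : PointProcess Ω (SmallSet d)}

/-- The points of the unit ball that stay at distance at least `ε * diam G` from all sets `G` of
`Φ` of diameter at least `2⁻ⁿ`. -/
def farSet (Φ : PointProcess Ω (SmallSet d)) (ε : ℝ) (n : ℕ) (ω : Ω) : Set (E d) :=
  closedBall 0 1 ∩ {x | ω ∈ Φ.void (nearFam ε x ((1 / 2) ^ n) 1)}

lemma isCompact_farSet (ε : ℝ) (n : ℕ) (ω : Ω) : IsCompact (farSet Φ ε n ω) := by
  refine (isCompact_closedBall 0 1).inter_right (isOpen_compl_iff.1 ?_)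
  have : {x : E d | ω ∈ Φ.void (nearFam ε x ((1 / 2) ^ n) 1)}ᶜ =
      ⋃ (m : ℕ) (_ : (m : ℕ∞) < Φ.total ω) (_ : Φ.point m ω ∈ diamFam d ((1 / 2) ^ n) 1)
        (y ∈ (Φ.point m ω).carrier), ball y (ε * (Φ.point m ω).diam) := by
    ext x
    simp only [PointProcess.void, nearFam, mem_compl_iff, mem_ofPred_eq, not_forall, not_not,
      mem_iUnion, exists_prop, mem_inter_iff, Set.Nonempty]
    constructor
    · rintro ⟨m, hm, ⟨y, hy, hxy⟩, hdm⟩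
      exact ⟨m, hm, hdm, y, hy, mem_ball_comm.1 hxy⟩
    · rintro ⟨m, hm, hdm, y, hy, hxy⟩
      exact ⟨m, hm, ⟨y, hy, mem_ball_comm.1 hxy⟩, hdm⟩
  rw [this]
  exact isOpen_iUnion fun m => isOpen_iUnion fun _ => isOpen_iUnion fun _ =>
    isOpen_biUnion fun y _ => isOpen_ball

lemma nearFam_subset_nearFam {ε a b c : ℝ} (h : a ≤ b) (x : E d) :
    nearFam ε x b c ⊆ nearFam ε x a c := fun _ hG => ⟨hG.1, h.trans hG.2.1, hG.2.2⟩

lemma antitone_farSet (ε : ℝ) (ω : Ω) : Antitone fun n => farSet Φ ε n ω := fun _ _ hmn x hx =>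
  ⟨hx.1, Φ.void_anti (nearFam_subset_nearFam
    (pow_le_pow_of_le_one (by norm_num) (by norm_num) hmn) x) hx.2⟩

/-- A far point can only be covered by sets of diameter zero, which form a countable set. -/
lemma uncovered_nonempty {ε : ℝ} (hε : 0 < ε) {ω : Ω}
    (h : ∀ Z : Set (E d), Z.Countable → ∃ x ∈ ⋂ n, farSet Φ ε n ω, x ∉ Z) :
    (uncovered Φ ω).Nonempty := by
  obtain ⟨x, hx, hxZ⟩ := h (⋃ (m : ℕ) (_ : (Φ.point m ω).diam = 0), (Φ.point m ω).carrier) (by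
    refine countable_iUnion fun m => countable_iUnion fun hm => ?_
    refine Set.Subsingleton.countable fun y hy z hz => ?_
    exact dist_le_zero.1 (((Φ.point m ω).dist_le_diam hy hz).trans_eq hm))
  refine ⟨x, fun hcov => ?_⟩
  simp only [mem_iUnion] at hcov hxZ
  obtain ⟨m, hm, hxm⟩ := hcov
  have hpos : 0 < (Φ.point m ω).diam := by
    refine lt_of_le_of_ne (Φ.point m ω).diam_nonneg fun h0 => hxZ ⟨m, h0.symm, hxm⟩
  obtain ⟨n, hn⟩ := exists_pow_lt_of_lt_one hpos (show (1 / 2 : ℝ) < 1 by norm_num)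
  exact (mem_iInter.1 hx n).2 m hm
    ⟨⟨x, hxm, mem_ball_self (by positivity)⟩, hn.le, (Φ.point m ω).diam_lt_one⟩

/-- The normalised Lebesgue measure on the far set; the normalisation is the inverse of the
probability that a given point is far. -/
noncomputable def farMeasure (Φ : PointProcess Ω (SmallSet d)) (ε a : ℝ) (n : ℕ) (ω : Ω) :
    Measure (E d) :=
  ENNReal.ofReal (Real.exp (n * a)) • volume.restrict (farSet Φ ε n ω)

/-- The `α`-energy of the normalised Lebesgue measure on the far set. -/
noncomputable def farEnergy (Φ : PointProcess Ω (SmallSet d)) (ε a α : ℝ) (n : ℕ) (ω : Ω) : ℝ≥0∞ :=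
  ENNReal.ofReal (Real.exp (n * a)) ^ 2 *
    ∫⁻ p in closedBall (0 : E d) 1 ×ˢ closedBall (0 : E d) 1,
      {p : E d × E d | ω ∈ Φ.void (nearFam ε p.1 ((1 / 2) ^ n) 1 ∪
        nearFam ε p.2 ((1 / 2) ^ n) 1)}.indicator (fun p => edist p.1 p.2 ^ (-α)) p

lemma farMeasure_univ (ε a : ℝ) (n : ℕ) (ω : Ω) : farMeasure Φ ε a n ω univ =
    ENNReal.ofReal (Real.exp (n * a)) * volume (farSet Φ ε n ω) := by
  rw [farMeasure, Measure.smul_apply, smul_eq_mul, Measure.restrict_apply_univ]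

/-- Small sets of large mass contribute to the energy. -/
lemma sq_farMeasure_le_farEnergy {ε a α : ℝ} (hα : 0 ≤ α) (n : ℕ) (ω : Ω) {B : Set (E d)}
    (hB : MeasurableSet B) {ρ : ℝ≥0∞}
    (hρ : ∀ x ∈ B ∩ closedBall 0 1, ∀ y ∈ B ∩ closedBall 0 1, edist x y ≤ ρ) :
    farMeasure Φ ε a n ω B ^ 2 * ρ ^ (-α) ≤ farEnergy Φ ε a α n ω := by
  have hFm : MeasurableSet (farSet Φ ε n ω) := (isCompact_farSet ε n ω).measurableSet
  have hBF := hB.inter hFm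
  rw [farMeasure, Measure.smul_apply, smul_eq_mul, Measure.restrict_apply hB, mul_pow, mul_assoc,
    farEnergy]
  refine mul_le_mul_right ?_ _
  calc volume (B ∩ farSet Φ ε n ω) ^ 2 * ρ ^ (-α)
      = ∫⁻ _p in (B ∩ farSet Φ ε n ω) ×ˢ (B ∩ farSet Φ ε n ω), ρ ^ (-α) := by
        rw [setLIntegral_const, Measure.volume_eq_prod, Measure.prod_prod, sq, mul_comm]
    _ ≤ ∫⁻ p in (B ∩ farSet Φ ε n ω) ×ˢ (B ∩ farSet Φ ε n ω),
        {p : E d × E d | ω ∈ Φ.void (nearFam ε p.1 ((1 / 2) ^ n) 1 ∪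
          nearFam ε p.2 ((1 / 2) ^ n) 1)}.indicator (fun p => edist p.1 p.2 ^ (-α)) p := by
        refine setLIntegral_mono' (hBF.prod hBF) fun p hp => ?_
        rw [indicator_of_mem]
        · rw [ENNReal.rpow_neg, ENNReal.rpow_neg]
          exact ENNReal.inv_le_inv.2 (ENNReal.rpow_le_rpow
            (hρ p.1 ⟨hp.1.1, hp.1.2.1⟩ p.2 ⟨hp.2.1, hp.2.2.1⟩) hα)
        · rw [mem_ofPred_eq, Φ.void_union]
          exact ⟨hp.1.2.2, hp.2.2.2⟩
    _ ≤ _ := lintegral_mono_set (prod_mono (fun x hx => hx.2.1) fun x hx => hx.2.1)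

variable [MeasurableSpace (SmallSet d)] {μ : Measure (SmallSet d)} {t : ℝ}

/-- A set close to both `x` and `y` has diameter at least `|x - y| / 4`. -/
lemma measure_nearFam_inter_le (hsuit : IsSuitable μ) (htrans : TranslationInvariant μ)
    (hscale : SemiScaleInvariant μ) (h1 : LocallyFinite μ) {ε : ℝ} (hε : ε ≤ 1) {x y : E d}
    {a N : ℕ} (hxy : (1 / 2 : ℝ) ^ N ≤ dist x y / 4) :
    μ (nearFam ε x ((1 / 2) ^ a) 1 ∩ nearFam ε y ((1 / 2) ^ a) 1) ≤
      N * μ (nearFam ε (0 : E d) (1 / 2) 1) := by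
  rw [← measure_nearFam_pow hsuit htrans hscale h1 hε x N]
  refine measure_mono ?_
  rintro G ⟨⟨⟨z, hz, hzx⟩, -⟩, ⟨w, hw, hwy⟩, -⟩
  refine ⟨⟨z, hz, hzx⟩, ?_, G.diam_lt_one⟩
  rw [mem_ball] at hzx hwy
  have h3 := dist_triangle4 x z w y
  rw [dist_comm x z] at h3
  have h4 := G.dist_le_diam hz hw
  have h5 : ε * G.diam ≤ 1 * G.diam := mul_le_mul_of_nonneg_right hε G.diam_nonneg
  linarith [G.diam_nonneg]

variable [MeasurableSpace Ω] {P : Measure Ω}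

/-- The one-point function: every point is far with the same probability `exp (-n a)`. -/
lemma measure_void_nearFam (hsuit : IsSuitable μ) (htrans : TranslationInvariant μ)
    (hscale : SemiScaleInvariant μ) (h1 : LocallyFinite μ) (ht : 0 < t)
    (hΦ : IsPoissonProcess P (ENNReal.ofReal t • μ) Φ) {ε : ℝ} (hε : ε ≤ 1) (x : E d) (n : ℕ) :
    P (Φ.void (nearFam ε x ((1 / 2) ^ n) 1)) =
      ENNReal.ofReal (Real.exp (-(n * (t * (μ (nearFam ε (0 : E d) (1 / 2) 1)).toReal)))) := by
  rw [hΦ.measure_void (hsuit.measurableSet_nearFam _ _ _ _)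
    (smul_ne_top (h1.nearFam_lt_top (by positivity) hε x)), toReal_smul ht,
    measure_nearFam_pow hsuit htrans hscale h1 hε, ENNReal.toReal_mul, ENNReal.toReal_natCast]
  congr 3
  ring

/-- The two-point estimate: the correlation of `x` and `y` being far is at most of order
`|x - y| ^ (-a / log 2)`, since it is governed by the sets close to both points. -/
lemma measure_void_pair_le (hsuit : IsSuitable μ) (htrans : TranslationInvariant μ)
    (hscale : SemiScaleInvariant μ) (h1 : LocallyFinite μ) (ht : 0 < t)
    (hΦ : IsPoissonProcess P (ENNReal.ofReal t • μ) Φ) {ε a : ℝ} (hε : ε ≤ 1)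
    (ha : a = t * (μ (nearFam ε (0 : E d) (1 / 2) 1)).toReal) {x y : E d}
    (hxy : x ≠ y) (hxy2 : dist x y < 4) (n : ℕ) :
    ENNReal.ofReal (Real.exp (n * a)) ^ 2 * P (Φ.void (nearFam ε x ((1 / 2) ^ n) 1 ∪
        nearFam ε y ((1 / 2) ^ n) 1)) ≤
      ENNReal.ofReal (Real.exp a * 4 ^ (a / Real.log 2)) * edist x y ^ (-(a / Real.log 2)) := by
  set m := (μ (nearFam ε (0 : E d) (1 / 2) 1)).toReal with hm
  have hmtop : μ (nearFam ε (0 : E d) (1 / 2) 1) ≠ ∞ := (h1.nearFam_lt_top (by norm_num) hε 0).ne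
  have ha0 : 0 ≤ a := by rw [ha]; positivity
  have hlog : 0 < Real.log 2 := Real.log_pos one_lt_two
  have hd0 : 0 < dist x y := dist_pos.2 hxy
  set F := nearFam ε x ((1 / 2) ^ n) 1 with hF
  set F' := nearFam ε y ((1 / 2) ^ n) 1 with hF'
  have hFm : MeasurableSet F := hsuit.measurableSet_nearFam _ _ _ _
  have hFm' : MeasurableSet F' := hsuit.measurableSet_nearFam _ _ _ _
  have hFt : μ F < ∞ := h1.nearFam_lt_top (by positivity) hε x
  have hFt' : μ F' < ∞ := h1.nearFam_lt_top (by positivity) hε y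
  have hFU : μ (F ∪ F') < ∞ := (measure_union_le _ _).trans_lt (ENNReal.add_lt_top.2 ⟨hFt, hFt'⟩)
  obtain ⟨N, hN, hN'⟩ := exists_pow_le_lt (x := dist x y / 4) (by positivity) (by linarith)
    (show (0 : ℝ) < 1 / 2 by norm_num) (by norm_num)
  have hinter : (μ (F ∩ F')).toReal ≤ (N + 1) * m := by
    have := ENNReal.toReal_mono (ENNReal.mul_ne_top (ENNReal.natCast_ne_top _) hmtop)
      (measure_nearFam_inter_le hsuit htrans hscale h1 hε (a := n) hN)
    rw [ENNReal.toReal_mul, ENNReal.toReal_natCast] at this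
    push_cast at this
    exact this
  have hFv : (μ F).toReal = n * m := by
    rw [hF, measure_nearFam_pow hsuit htrans hscale h1 hε, ENNReal.toReal_mul,
      ENNReal.toReal_natCast]
  have hFv' : (μ F').toReal = n * m := by
    rw [hF', measure_nearFam_pow hsuit htrans hscale h1 hε, ENNReal.toReal_mul,
      ENNReal.toReal_natCast]
  have hunion : (μ (F ∪ F')).toReal + (μ (F ∩ F')).toReal = n * m + n * m := by
    rw [← hFv, ← ENNReal.toReal_add hFU.ne
      ((measure_mono inter_subset_left).trans_lt hFt).ne, measure_union_add_inter _ hFm',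
      ENNReal.toReal_add hFt.ne hFt'.ne, hFv, hFv']
  rw [hΦ.measure_void (hFm.union hFm') (smul_ne_top hFU), toReal_smul ht,
    ← ENNReal.ofReal_pow (by positivity), ← ENNReal.ofReal_mul (by positivity), edist_dist,
    ENNReal.ofReal_rpow_of_pos hd0, ← ENNReal.ofReal_mul (by positivity)]
  refine ENNReal.ofReal_le_ofReal ?_
  have hN2 : Real.exp (N * a) ≤ (4 / dist x y) ^ (a / Real.log 2) := by
    rw [Real.rpow_def_of_pos (by positivity)]
    refine Real.exp_le_exp.2 ?_
    have : N * Real.log 2 ≤ Real.log (4 / dist x y) := by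
      rw [← Real.log_pow]
      refine Real.log_le_log (by positivity) ?_
      rw [le_div_iff₀ hd0]
      have h2 : (2 : ℝ) ^ N * (1 / 2) ^ N = 1 := by rw [← mul_pow]; norm_num
      have h3 : (0 : ℝ) < 2 ^ N := by positivity
      nlinarith
    calc N * a = N * Real.log 2 * (a / Real.log 2) := by field_simp
      _ ≤ _ := by gcongr
  calc Real.exp (n * a) ^ 2 * Real.exp (-(t * (μ (F ∪ F')).toReal))
      = Real.exp (t * (μ (F ∩ F')).toReal) := by
        rw [← Real.exp_nat_mul, ← Real.exp_add]
        congr 1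
        push_cast
        rw [ha]
        linear_combination t * (-hunion)
    _ ≤ Real.exp a * Real.exp (N * a) := by
        rw [← Real.exp_add]
        refine Real.exp_le_exp.2 ?_
        have := mul_le_mul_of_nonneg_left hinter ht.le
        rw [ha]
        linarith
    _ ≤ Real.exp a * (4 / dist x y) ^ (a / Real.log 2) := by gcongr
    _ = _ := by
        rw [Real.div_rpow (by norm_num) hd0.le, Real.rpow_neg hd0.le]
        ring

lemma measurableSet_far_prod (hsuit : IsSuitable μ)
    (hΦ : IsPoissonProcess P (ENNReal.ofReal t • μ) Φ) (ε : ℝ) (n : ℕ) :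
    MeasurableSet {q : Ω × E d | q.1 ∈ Φ.void (nearFam ε q.2 ((1 / 2) ^ n) 1)} :=
  hΦ.measurableSet_void_prod (F := fun x : E d => nearFam ε x ((1 / 2) ^ n) 1)
    (hsuit.joint_nearFam ε _ _)

lemma measurableSet_far_pair (hsuit : IsSuitable μ)
    (hΦ : IsPoissonProcess P (ENNReal.ofReal t • μ) Φ) (ε : ℝ) (n : ℕ) :
    MeasurableSet {q : Ω × (E d × E d) | q.1 ∈ Φ.void (nearFam ε q.2.1 ((1 / 2) ^ n) 1 ∪
      nearFam ε q.2.2 ((1 / 2) ^ n) 1)} := by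
  refine hΦ.measurableSet_void_prod (F := fun p : E d × E d =>
    nearFam ε p.1 ((1 / 2) ^ n) 1 ∪ nearFam ε p.2 ((1 / 2) ^ n) 1) (MeasurableSet.union ?_ ?_)
  · exact (show Measurable fun p : (E d × E d) × SmallSet d => (p.1.1, p.2) by fun_prop)
      (hsuit.joint_nearFam ε ((1 / 2) ^ n) 1)
  · exact (show Measurable fun p : (E d × E d) × SmallSet d => (p.1.2, p.2) by fun_prop)
      (hsuit.joint_nearFam ε ((1 / 2) ^ n) 1)

lemma measurableSet_mem_farSet (hsuit : IsSuitable μ)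
    (hΦ : IsPoissonProcess P (ENNReal.ofReal t • μ) Φ) (ε : ℝ) (n : ℕ) :
    MeasurableSet {q : Ω × E d | q.2 ∈ farSet Φ ε n q.1} :=
  (measurable_snd measurableSet_closedBall).inter (measurableSet_far_prod hsuit hΦ ε n)

lemma measurable_farMeasure_univ (hsuit : IsSuitable μ)
    (hΦ : IsPoissonProcess P (ENNReal.ofReal t • μ) Φ) (ε a : ℝ) (n : ℕ) :
    Measurable fun ω => farMeasure Φ ε a n ω univ := by
  simp only [farMeasure_univ]
  exact (measurable_measure_prodMk_left (measurableSet_mem_farSet hsuit hΦ ε n)).const_mul _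

lemma measurable_farEnergy_integrand (hsuit : IsSuitable μ)
    (hΦ : IsPoissonProcess P (ENNReal.ofReal t • μ) Φ) (ε α : ℝ) (n : ℕ) :
    Measurable fun q : Ω × (E d × E d) =>
      {p : E d × E d | q.1 ∈ Φ.void (nearFam ε p.1 ((1 / 2) ^ n) 1 ∪
        nearFam ε p.2 ((1 / 2) ^ n) 1)}.indicator (fun p => edist p.1 p.2 ^ (-α)) q.2 := by
  have hk : Measurable fun q : Ω × (E d × E d) => edist q.2.1 q.2.2 ^ (-α) :=
    (measurable_edist.comp measurable_snd).pow_const _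
  exact hk.indicator (measurableSet_far_pair hsuit hΦ ε n)

lemma measurable_farEnergy (hsuit : IsSuitable μ)
    (hΦ : IsPoissonProcess P (ENNReal.ofReal t • μ) Φ) (ε a α : ℝ) (n : ℕ) :
    Measurable fun ω => farEnergy Φ ε a α n ω :=
  ((measurable_farEnergy_integrand hsuit hΦ ε α n).lintegral_prod_right').const_mul _

lemma lintegral_farMeasure_univ [IsProbabilityMeasure P] (hsuit : IsSuitable μ)
    (htrans : TranslationInvariant μ) (hscale : SemiScaleInvariant μ) (h1 : LocallyFinite μ)
    (ht : 0 < t) (hΦ : IsPoissonProcess P (ENNReal.ofReal t • μ) Φ) {ε a : ℝ} (hε : ε ≤ 1)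
    (ha : a = t * (μ (nearFam ε (0 : E d) (1 / 2) 1)).toReal) (n : ℕ) :
    ∫⁻ ω, farMeasure Φ ε a n ω univ ∂P = volume (closedBall (0 : E d) 1) := by
  have hS := measurableSet_mem_farSet hsuit hΦ ε n
  have hSm : Measurable fun ω => volume (farSet Φ ε n ω) := measurable_measure_prodMk_left hS
  simp only [farMeasure_univ]
  rw [lintegral_const_mul _ hSm]
  have hsec : ∫⁻ ω, volume (farSet Φ ε n ω) ∂P =
      ∫⁻ x in closedBall (0 : E d) 1, ENNReal.ofReal (Real.exp (-(n * a))) := by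
    calc ∫⁻ ω, volume (farSet Φ ε n ω) ∂P
        = (P.prod volume) {q : Ω × E d | q.2 ∈ farSet Φ ε n q.1} := (Measure.prod_apply hS).symm
      _ = ∫⁻ x : E d, P {ω | x ∈ farSet Φ ε n ω} := Measure.prod_apply_symm hS
      _ = _ := by
          rw [← lintegral_indicator measurableSet_closedBall]
          refine lintegral_congr fun x => ?_
          by_cases hx : x ∈ closedBall (0 : E d) 1
          · rw [indicator_of_mem hx, ha,
              ← measure_void_nearFam hsuit htrans hscale h1 ht hΦ hε x n]
            congr 1
            ext ω
            simp only [farSet, mem_ofPred_eq, mem_inter_iff, hx, true_and]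
          · rw [indicator_of_notMem hx]
            convert measure_empty (μ := P)
            exact eq_empty_of_forall_notMem fun ω hω => hx hω.1
  rw [hsec, setLIntegral_const, ← mul_assoc, ← ENNReal.ofReal_mul (by positivity), ← Real.exp_add,
    add_neg_cancel, Real.exp_zero, ENNReal.ofReal_one, one_mul]

/-- The mean `α`-energy stays bounded: by the two-point estimate it is at most a multiple of the
Riesz energy of the unit ball of exponent `α + a / log 2 < d`. -/
lemma exists_lintegral_farEnergy_le (hd : 0 < d) [IsProbabilityMeasure P] (hsuit : IsSuitable μ)
    (htrans : TranslationInvariant μ) (hscale : SemiScaleInvariant μ) (h1 : LocallyFinite μ)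
    (ht : 0 < t) (hΦ : IsPoissonProcess P (ENNReal.ofReal t • μ) Φ) {ε a α : ℝ} (hε : ε ≤ 1)
    (ha : a = t * (μ (nearFam ε (0 : E d) (1 / 2) 1)).toReal)
    (hα : α + a / Real.log 2 < d) :
    ∃ C : ℝ≥0∞, C ≠ ∞ ∧ ∀ n, ∫⁻ ω, farEnergy Φ ε a α n ω ∂P ≤ C := by
  have : Nonempty (Fin d) := ⟨⟨0, hd⟩⟩
  have ha0 : 0 ≤ a / Real.log 2 := by
    rw [ha]
    have := Real.log_pos one_lt_two
    positivity
  set C₁ := ENNReal.ofReal (Real.exp a * 4 ^ (a / Real.log 2)) with hC₁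
  refine ⟨C₁ * ∫⁻ p in closedBall (0 : E d) 1 ×ˢ closedBall (0 : E d) 1,
    edist p.1 p.2 ^ (-(α + a / Real.log 2)),
    ENNReal.mul_ne_top ENNReal.ofReal_ne_top (lintegral_edist_rpow_lt_top hd hα).ne, fun n => ?_⟩
  have hmeas := measurable_farEnergy_integrand hsuit hΦ ε α n
  simp only [farEnergy]
  rw [lintegral_const_mul _ hmeas.lintegral_prod_right',
    lintegral_lintegral_swap hmeas.aemeasurable,
    ← lintegral_const_mul' _ _ (ENNReal.pow_ne_top ENNReal.ofReal_ne_top),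
    ← lintegral_const_mul' _ _ ENNReal.ofReal_ne_top]
  refine setLIntegral_mono_ae' (measurableSet_closedBall.prod measurableSet_closedBall) ?_
  have hdiag : ∀ᵐ p : E d × E d, p.1 ≠ p.2 := by
    rw [Measure.volume_eq_prod]
    have hD : MeasurableSet {p : E d × E d | p.1 ≠ p.2} := measurableSet_diagonal.compl
    refine (Measure.ae_prod_iff_ae_ae hD).2 (.of_forall fun x => ?_)
    filter_upwards [compl_mem_ae_iff.2 (measure_singleton (μ := volume) x)] with y hy
    exact fun h => hy h.symm
  filter_upwards [hdiag] with p hp hpK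
  have hdist : dist p.1 p.2 < 4 := by
    have h2 := dist_triangle_right p.1 p.2 0
    have h3 := mem_closedBall.1 hpK.1
    have h4 := mem_closedBall.1 hpK.2
    linarith
  have hinner : ∫⁻ ω, {p : E d × E d | ω ∈ Φ.void (nearFam ε p.1 ((1 / 2) ^ n) 1 ∪
        nearFam ε p.2 ((1 / 2) ^ n) 1)}.indicator (fun p => edist p.1 p.2 ^ (-α)) p ∂P =
      edist p.1 p.2 ^ (-α) * P (Φ.void (nearFam ε p.1 ((1 / 2) ^ n) 1 ∪
        nearFam ε p.2 ((1 / 2) ^ n) 1)) := by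
    rw [← lintegral_indicator_const (hΦ.measurableSet_void
      ((hsuit.measurableSet_nearFam _ _ _ _).union (hsuit.measurableSet_nearFam _ _ _ _)))]
    exact lintegral_congr fun ω => indicator_eq_indicator_of_iff Iff.rfl rfl
  rw [hinner]
  have h5 := measure_void_pair_le hsuit htrans hscale h1 ht hΦ hε ha hp hdist n
  have hed0 : edist p.1 p.2 ≠ 0 := (edist_pos.2 hp).ne'
  calc _ = edist p.1 p.2 ^ (-α) * (ENNReal.ofReal (Real.exp (n * a)) ^ 2 *
        P (Φ.void (nearFam ε p.1 ((1 / 2) ^ n) 1 ∪ nearFam ε p.2 ((1 / 2) ^ n) 1))) := by ring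
    _ ≤ edist p.1 p.2 ^ (-α) * (C₁ * edist p.1 p.2 ^ (-(a / Real.log 2))) := by gcongr
    _ = C₁ * edist p.1 p.2 ^ (-(α + a / Real.log 2)) := by
        rw [neg_add, ENNReal.rpow_add _ _ hed0 (edist_ne_top _ _)]
        ring

/-- Below the critical intensity there are uncovered points with positive probability. -/
lemma not_ae_uncovered_eq_empty (hd : 0 < d) [IsProbabilityMeasure P] (hsuit : IsSuitable μ)
    (htrans : TranslationInvariant μ) (hscale : SemiScaleInvariant μ) (h1 : LocallyFinite μ)
    (h2 : NullBoundary μ) (ht : 0 < t) (hcrit : t * (unitMass μ).toReal < d * Real.log 2)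
    (hΦ : IsPoissonProcess P (ENNReal.ofReal t • μ) Φ) : ¬ ∀ᵐ ω ∂P, uncovered Φ ω = ∅ := by
  intro hae
  have hlog : 0 < Real.log 2 := Real.log_pos one_lt_two
  have hlt : unitMass μ < ENNReal.ofReal (d * Real.log 2 / t) := by
    rw [← ENNReal.ofReal_toReal h1.unitMass_lt_top.ne]
    refine (ENNReal.ofReal_lt_ofReal_iff (by positivity)).2 ?_
    rw [lt_div_iff₀ ht]
    linarith
  obtain ⟨ε, hε0, hε1, hε⟩ := exists_nearFam_lt hsuit htrans h1 h2 hlt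
  set a := t * (μ (nearFam ε (0 : E d) (1 / 2) 1)).toReal with ha
  have had : a / Real.log 2 < d := by
    have h3 := (ENNReal.toReal_lt_toReal hε.ne_top ENNReal.ofReal_ne_top).2 hε
    rw [ENNReal.toReal_ofReal (by positivity), lt_div_iff₀ ht] at h3
    rw [div_lt_iff₀ hlog, ha]
    linarith
  -- The exponent leaves room on both sides: positive energy exponent, finite Riesz energy.
  set α := (d - a / Real.log 2) / 2 with hα
  have hα0 : 0 < α := by rw [hα]; linarith
  obtain ⟨C, hC, hJC⟩ := exists_lintegral_farEnergy_le hd hsuit htrans hscale h1 ht hΦ hε1 ha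
    (α := α) (by rw [hα]; linarith)
  have hV0 : volume (closedBall (0 : E d) 1) ≠ 0 :=
    (measure_closedBall_pos volume (0 : E d) one_pos).ne'
  have hV : volume (closedBall (0 : E d) 1) ≠ ∞ := measure_closedBall_lt_top.ne
  have hD : (2 : ℝ≥0∞) ^ α ≠ ∞ := ENNReal.rpow_ne_top_of_nonneg hα0.le (by norm_num)
  have hD0 : (2 : ℝ≥0∞) ^ α ≠ 0 := (ENNReal.rpow_pos (by norm_num) (by norm_num)).ne'
  have hXJ : ∀ n ω, farMeasure Φ ε a n ω univ ^ 2 ≤ 2 ^ α * farEnergy Φ ε a α n ω := by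
    intro n ω
    have h3 := sq_farMeasure_le_farEnergy (Φ := Φ) (ε := ε) (a := a) hα0.le n ω MeasurableSet.univ
      (ρ := 2) (by
        rintro x ⟨-, hx⟩ y ⟨-, hy⟩
        rw [edist_dist]
        refine ENNReal.ofReal_le_of_le_toReal ((dist_triangle_right x y 0).trans ?_)
        rw [mem_closedBall] at hx hy
        rw [ENNReal.toReal_ofNat]
        linarith)
    calc farMeasure Φ ε a n ω univ ^ 2
        = 2 ^ α * (farMeasure Φ ε a n ω univ ^ 2 * 2 ^ (-α)) := by
          rw [ENNReal.rpow_neg, mul_left_comm, ENNReal.mul_inv_cancel hD0 hD, mul_one]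
      _ ≤ _ := by gcongr
  obtain ⟨M, c, hM, hc, hgood⟩ := exists_measure_ge hV0 hV hC hD
  set A : ℕ → Set Ω := fun n => {ω | volume (closedBall (0 : E d) 1) / 2 ≤
    farMeasure Φ ε a n ω univ ∧ farEnergy Φ ε a α n ω ≤ M} with hA
  have hcA : ∀ n, c ≤ P (A n) := fun n =>
    hgood P _ _ (measurable_farMeasure_univ hsuit hΦ ε a n) (measurable_farEnergy hsuit hΦ ε a α n)
      (lintegral_farMeasure_univ hsuit htrans hscale h1 ht hΦ hε1 ha n) (hJC n) (hXJ n)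
  have hAm : ∀ n, MeasurableSet (A n) := fun n =>
    (measurableSet_le measurable_const (measurable_farMeasure_univ hsuit hΦ ε a n)).inter
      (measurableSet_le (measurable_farEnergy hsuit hΦ ε a α n) measurable_const)
  -- The good events occur infinitely often with probability at least `c`.
  have hlimsup : c ≤ P (⋂ N : ℕ, ⋃ n ≥ N, A n) := by
    refine ge_of_tendsto' (tendsto_measure_iInter_atTop
      (fun N => (MeasurableSet.iUnion fun n => .iUnion fun _ => hAm n).nullMeasurableSet)
      (fun N N' hNN' => ?_) ⟨0, measure_ne_top P _⟩) fun N => ?_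
    · exact biUnion_subset_biUnion_left fun n hn => le_trans hNN' hn
    · exact (hcA N).trans (measure_mono (subset_iUnion₂ (s := fun n (_ : n ≥ N) => A n) N le_rfl))
  obtain ⟨ω, hωA, hω⟩ : ∃ ω ∈ ⋂ N : ℕ, ⋃ n ≥ N, A n, uncovered Φ ω = ∅ := by
    by_contra! hcon
    refine hc (le_antisymm (hlimsup.trans ?_) bot_le)
    refine (measure_mono_null (fun ω hω => ?_) hae).le
    exact (hcon ω hω).ne_empty
  refine (uncovered_nonempty hε0 fun Z hZ => ?_ : (uncovered Φ ω).Nonempty).ne_empty hω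
  refine exists_mem_iInter_notMem (fun n => isCompact_farSet ε n ω) (antitone_farSet ε ω)
    (ν := fun n => farMeasure Φ ε a n ω) (V := volume (closedBall (0 : E d) 1) / 2)
    (ENNReal.div_pos hV0 (by norm_num)).ne' (good := fun n => ω ∈ A n) ?_ ?_ ?_ hZ
  · rw [frequently_atTop]
    intro N
    obtain ⟨n, hn, h⟩ := mem_iUnion₂.1 (mem_iInter.1 hωA N)
    exact ⟨n, hn, h⟩
  · intro n hn
    refine hn.1.trans_eq ?_
    rw [farMeasure_univ, farMeasure, Measure.smul_apply, smul_eq_mul, Measure.restrict_apply_self]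
  · intro z η hη
    have hlim : Tendsto (fun r : ℝ => M * ENNReal.ofReal (2 * r) ^ α) (𝓝 0) (𝓝 0) := by
      have h3 : Tendsto (fun r : ℝ => ENNReal.ofReal (2 * r) ^ α) (𝓝 0) (𝓝 0) := by
        have h4 : Continuous fun r : ℝ => ENNReal.ofReal (2 * r) ^ α :=
          ENNReal.continuous_rpow_const.comp
            (ENNReal.continuous_ofReal.comp (continuous_const.mul continuous_id))
        have h5 := h4.tendsto 0
        simpa [hα0] using h5
      simpa using ENNReal.Tendsto.const_mul h3 (Or.inr hM)
    have hη2 : 0 < η ^ 2 := pos_iff_ne_zero.2 (pow_ne_zero 2 hη)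
    obtain ⟨r, hr, hr0⟩ := (((hlim.mono_left nhdsWithin_le_nhds).eventually
      (gt_mem_nhds hη2)).and (self_mem_nhdsWithin (s := Ioi (0 : ℝ)))).exists
    refine ⟨r, hr0, fun n hn => ?_⟩
    have hr0' : 0 < 2 * r := mul_pos two_pos hr0
    have hpos : ENNReal.ofReal (2 * r) ^ α ≠ 0 :=
      (ENNReal.rpow_pos (ENNReal.ofReal_pos.2 hr0') ENNReal.ofReal_ne_top).ne'
    have htop : ENNReal.ofReal (2 * r) ^ α ≠ ∞ :=
      ENNReal.rpow_ne_top_of_nonneg hα0.le ENNReal.ofReal_ne_top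
    have h3 := (sq_farMeasure_le_farEnergy (Φ := Φ) (ε := ε) (a := a) hα0.le n ω
      (measurableSet_ball (x := z) (ε := r)) (ρ := ENNReal.ofReal (2 * r)) (by
        rintro x ⟨hx, -⟩ y ⟨hy, -⟩
        rw [edist_dist]
        refine ENNReal.ofReal_le_ofReal ((dist_triangle_right x y z).trans ?_)
        rw [mem_ball] at hx hy
        linarith)).trans hn.2
    have h4 : farMeasure Φ ε a n ω (ball z r) ^ 2 ≤ η ^ 2 := by
      calc _ = farMeasure Φ ε a n ω (ball z r) ^ 2 * ENNReal.ofReal (2 * r) ^ (-α) *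
            ENNReal.ofReal (2 * r) ^ α := by
            rw [ENNReal.rpow_neg, mul_assoc, ENNReal.inv_mul_cancel hpos htop, mul_one]
        _ ≤ M * ENNReal.ofReal (2 * r) ^ α := by gcongr
        _ ≤ η ^ 2 := hr.le
    exact (ENNReal.pow_le_pow_left_iff two_ne_zero).1 h4

end Subcritical

end PoissonFractal

/-! ### The critical value -/

open PoissonFractal in
theorem theorem1p2 {d : ℕ} (hd : 0 < d)
    [MeasurableSpace (PoissonFractal.SmallSet d)]
    (μ : Measure (PoissonFractal.SmallSet d))
    (hsuit : PoissonFractal.IsSuitable μ)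
    (htrans : PoissonFractal.TranslationInvariant μ)
    (hscale : PoissonFractal.SemiScaleInvariant μ)
    (h1 : PoissonFractal.LocallyFinite μ)
    (h2 : PoissonFractal.NullBoundary μ)
    (h3 : PoissonFractal.ChargesPositiveVolume μ)
    (hint : PoissonFractal.BoundaryIntegrable μ)
    {Ω : Type*} [MeasurableSpace Ω] (P : Measure Ω) [IsProbabilityMeasure P]
    (Φ : ℝ → PoissonFractal.PointProcess Ω (PoissonFractal.SmallSet d))
    (hΦ : ∀ t : ℝ, 0 < t → PoissonFractal.IsPoissonProcess P (ENNReal.ofReal t • μ) (Φ t)) :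
    0 < PoissonFractal.criticalValue P Φ ∧
      ∀ᵐ ω ∂P, PoissonFractal.uncovered (Φ (PoissonFractal.criticalValue P Φ)) ω = ∅ := by
  have hm : unitMass μ ≠ 0 := (unitMass_pos hd hsuit htrans hscale h1 h2 h3).ne'
  have hm0 : 0 < (unitMass μ).toReal := ENNReal.toReal_pos hm h1.unitMass_lt_top.ne
  have hlog : 0 < Real.log 2 := Real.log_pos one_lt_two
  have hd' : (0 : ℝ) < d := by exact_mod_cast hd
  set t₀ : ℝ := d * Real.log 2 / (unitMass μ).toReal with ht₀
  have ht₀pos : 0 < t₀ := by positivity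
  have hcov : ∀ᵐ ω ∂P, uncovered (Φ t₀) ω = ∅ :=
    ae_uncovered_eq_empty hd hsuit htrans hscale h1 h2 hint ht₀pos hm
      (by rw [ht₀, div_mul_cancel₀ _ hm0.ne']) (hΦ t₀ ht₀pos)
  have hcrit : criticalValue P Φ = t₀ := by
    refine IsLeast.csInf_eq ⟨⟨ht₀pos, hcov⟩, ?_⟩
    rintro t ⟨ht, hae⟩
    by_contra! hlt
    refine not_ae_uncovered_eq_empty hd hsuit htrans hscale h1 h2 ht ?_ (hΦ t ht) hae
    rwa [ht₀, lt_div_iff₀ hm0] at hlt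
  rw [hcrit]
  exact ⟨ht₀pos, hcov⟩
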